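/- Let $k \ge 2$ and $\ell \ge 2$ be integers, and let $G$ be a finite simple undirected $k$-connected graph (that is, its vertex connectivity satisfies $\kappa(G) \ge k$) of order $$n \ge \max\left\{k\ell + \max\{k\ell - 6,\, 2\ell\} + 3k,\ \ 6k + 8\ell + 4 - 2\left\lceil \frac{k-2}{k} \right\rceil\right\}$$ with minimum degree $\delta(G) \ge \frac{n}{2}$. If $G$ has a Hamiltonian cycle $H$ such that $G - E(H)$ is not $k$-connected, then there are $\ell$ pairwise edge-disjoint Hamiltonian cycles $H_1, H_2, \ldots, H_\ell$ in $G$ such that $G - \bigcup_{1 \le i \le \ell} E(H_i)$ is $k$-connected. (Here $G - F$ denotes the graph obtained from $G$ by deleting the edges in $F$ and keeping all vertices.) -/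

import Mathlib

/-- The (vertex) connectivity `κ(G)` of a finite simple graph: the least number of vertices whose
deletion leaves a disconnected graph or a graph with at most one vertex. -/
noncomputable def SimpleGraph.vertexConnectivity {V : Type*} [Fintype V] (G : SimpleGraph V) : ℕ :=
  sInf {m : ℕ | ∃ S : Finset V, S.card = m ∧
    (¬ (G.induce {v : V | v ∉ S}).Connected ∨ Fintype.card V ≤ S.card + 1)}

/-- A graph is `k`-connected if its connectivity is at least `k`. -/
def SimpleGraph.IsKConnected {V : Type*} [Fintype V] (G : SimpleGraph V) (k : ℕ) : Prop :=
  k ≤ G.vertexConnectivity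

/-! Put n = |V| and d = δ(G), so n ≤ 2d. Since G - E(H) is not k-connected, fewer than k vertices S
separate it into parts A and B. Every A-B edge of G then lies in H, so each vertex has at most two
neighbours across. As d ≥ n/2, both parts have about n/2 vertices and are nearly complete; `IsSplit`
records this with d ≥ 3k + 4l + 1.

Connectivity is protected in advance. Assign each vertex of S to the side holding most of its
neighbours. By k-connectivity and the deficiency form of Hall's theorem
(`IsKConnected.exists_matching`), k disjoint edges join the two sides; reserve them as R. Deleting l
Hamiltonian cycles that avoid R costs each vertex at most 2l edges. After removing fewer than k
further vertices, each side is still connected and some edge of R survives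
(`isKConnected_of_matching`). It remains to find l edge-disjoint Hamiltonian cycles avoiding R.

A single cycle needs two disjoint A-B paths with inner vertices in S. A localised Bondy–Chvátal
closure lets A and B be treated as cliques. The other vertices of S are then absorbed by short
detours, and the cliques are traversed between the ends of the two paths
(`exists_isHamList_of_crossing`).

To repeat this l times the crossings must be rationed. If two vertices of S have at least l + 2
neighbours in both A and B, every cycle crosses through these two (`exists_family_of_two_rich`).
Otherwise at most one vertex of S is of this kind, and the rest of S is sparse towards A or towards
B. Attach each sparse vertex to the part towards which it is not known to be sparse. By the degree
bound, each vertex of the part on the smaller side has a neighbour on the other side; fix one such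
edge per vertex. No endpoint on the other side meets more than l + 1 of these edges, so every cycle
can cross along two fresh ones with distinct endpoints (`exists_family_of_stars`). In both cases a
forbidden set F keeps a cycle from using more of the rationed edges than intended. -/

namespace SimpleGraph

variable {V : Type*}

/-- The neighbours of `v` lying in the finite set `X`. -/
noncomputable def nbrsIn (G : SimpleGraph V) (v : V) (X : Finset V) : Finset V :=
  haveI := Classical.decPred (G.Adj v)
  X.filter (G.Adj v)

@[simp] lemma mem_nbrsIn {G : SimpleGraph V} {v y : V} {X : Finset V} :
    y ∈ G.nbrsIn v X ↔ y ∈ X ∧ G.Adj v y := by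
  simp [nbrsIn]

lemma nbrsIn_mono {G G' : SimpleGraph V} (h : G ≤ G') {v : V} {X Y : Finset V} (hX : X ⊆ Y) :
    G.nbrsIn v X ⊆ G'.nbrsIn v Y := by
  intro y hy
  rw [mem_nbrsIn] at hy ⊢
  exact ⟨hX hy.1, h hy.2⟩

/-! ### Hamiltonian cycles as cyclic lists, and a localised closure -/

/-- A list enumerating the vertices of a Hamiltonian cycle of `G` in cyclic order. -/
structure IsHamList (G : SimpleGraph V) (L : List V) : Prop where
  nodup : L.Nodup
  mem : ∀ v, v ∈ L
  chain : L.IsChain G.Adj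
  close : ∀ x ∈ L.getLast?, ∀ y ∈ L.head?, G.Adj x y

/-- A Hamiltonian cycle after adding the edge `uv` is one of the original graph, or becomes
a Hamiltonian path between `u` and `v`. -/
lemma IsHamList.of_sup_edge {G : SimpleGraph V} {u v : V} {L : List V}
    (hL : (G ⊔ edge u v).IsHamList L) (hlen : 3 ≤ L.length) :
    G.IsHamList L ∨ ∃ x y T, (x = u ∧ y = v ∨ x = v ∧ y = u) ∧ (y :: T ++ [x]).Nodup ∧
      (∀ w, w ∈ y :: T ++ [x]) ∧ (y :: T ++ [x]).IsChain G.Adj := by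
  have key : ∀ x y T, (y :: T ++ [x]).Nodup → (∀ w, w ∈ y :: T ++ [x]) → ¬ G.Adj x y →
      (G ⊔ edge u v).Adj x y → (y :: T ++ [x]).IsChain (G ⊔ edge u v).Adj →
      3 ≤ (y :: T ++ [x]).length →
      ∃ x y T, (x = u ∧ y = v ∨ x = v ∧ y = u) ∧ (y :: T ++ [x]).Nodup ∧
      (∀ w, w ∈ y :: T ++ [x]) ∧ (y :: T ++ [x]).IsChain G.Adj := by
    intro x y T hnd hmem hnot hadj hch hl
    have hxy : x = u ∧ y = v ∨ x = v ∧ y = u := by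
      rw [sup_adj, edge_adj] at hadj
      tauto
    refine ⟨x, y, T, hxy, hnd, hmem, ?_⟩
    rw [List.isChain_iff_getElem] at hch ⊢
    intro i hi
    by_contra hcon
    have h1 := hch i hi
    rw [sup_adj, edge_adj] at h1
    have h2 : (y :: T ++ [x])[i] = x ∧ (y :: T ++ [x])[i+1] = y ∨
        (y :: T ++ [x])[i] = y ∧ (y :: T ++ [x])[i+1] = x := by
      rcases hxy with ⟨rfl, rfl⟩ | ⟨rfl, rfl⟩ <;> tauto
    have h0 : (y :: T ++ [x])[0]'(by simp) = y := by simp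
    have hlast : (y :: T ++ [x])[(y :: T ++ [x]).length - 1]'(by simp) = x := by simp
    -- The ends of the missing edge occupy the first and last positions. They could also be
    -- consecutive inside the list only if it had length two.
    rcases h2 with ⟨h2, -⟩ | ⟨h2, h3⟩
    · have h4 := hnd.getElem_inj_iff.1 (h2.trans hlast.symm)
      omega
    · have h4 := hnd.getElem_inj_iff.1 (h2.trans h0.symm)
      have h5 := hnd.getElem_inj_iff.1 (h3.trans hlast.symm)
      omega
  by_cases hch : L.IsChain G.Adj
  · by_cases hcl : ∀ x ∈ L.getLast?, ∀ y ∈ L.head?, G.Adj x y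
    · exact Or.inl ⟨hL.nodup, hL.mem, hch, hcl⟩
    · right
      push Not at hcl
      obtain ⟨x, hx, y, hy, hxy⟩ := hcl
      have hadj := hL.close x hx y hy
      obtain ⟨T, rfl⟩ : ∃ T, L = y :: T ++ [x] := by
        rcases L with _ | ⟨z, L⟩
        · simp at hx
        · simp only [List.head?_cons, Option.mem_def, Option.some.injEq] at hy
          subst hy
          obtain rfl | ⟨T, w, rfl⟩ := List.eq_nil_or_concat' L
          · simp at hlen
          · simp only [← List.cons_append, List.getLast?_append, List.getLast?_singleton,
              Option.some_or, Option.mem_def, Option.some.injEq] at hx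
            subst hx
            exact ⟨T, by simp⟩
      exact key x y T hL.nodup hL.mem hxy hadj hL.chain hlen
  · right
    rw [List.isChain_iff_forall_rel_of_append_cons_cons] at hch
    push Not at hch
    obtain ⟨x, y, L1, L2, rfl, hxy⟩ := hch
    have hp : (y :: (L2 ++ L1) ++ [x]).Perm (L1 ++ x :: y :: L2) := by
      have : (L1 ++ x :: y :: L2) = (L1 ++ [x]) ++ (y :: L2) := by simp
      rw [this]
      have h2 : (y :: (L2 ++ L1) ++ [x]) = (y :: L2) ++ (L1 ++ [x]) := by simp
      rw [h2]
      exact List.perm_append_comm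
    have hc := hL.chain
    have hadj := (List.isChain_append_cons_cons.mp hc).2.1
    refine key x y (L2 ++ L1) (hp.nodup_iff.2 hL.nodup) (fun w => hp.mem_iff.2 (hL.mem w)) hxy
      hadj ?_ (by rw [hp.length_eq]; exact hlen)
    have h2 : (y :: (L2 ++ L1) ++ [x]) = (y :: L2) ++ (L1 ++ [x]) := by simp
    rw [h2]
    rw [List.isChain_append_cons_cons] at hc
    refine List.IsChain.append hc.2.2 hc.1 ?_
    intro a ha b hb
    refine hL.close a ?_ b ?_
    · simpa [List.getLast?_append] using ha
    · cases L1 <;> simpa using hb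

/-- Exchanging two edges of a Hamiltonian path inside `X` closes it up to a Hamiltonian cycle.
`Y` contains all vertices outside `X` that have a neighbour in `X`. -/
lemma exists_isHamList_of_path [DecidableEq V] {G : SimpleGraph V} {X Y : Finset V} {x y : V}
    {T : List V}
    (hx : x ∈ X) (hY : ∀ a b, a ∉ X → b ∈ X → G.Adj a b → a ∈ Y)
    (hdeg : X.card + Y.card ≤ (G.nbrsIn x X).card + (G.nbrsIn y X).card)
    (hnd : (y :: T ++ [x]).Nodup) (hmem : ∀ w, w ∈ y :: T ++ [x])
    (hch : (y :: T ++ [x]).IsChain G.Adj) : ∃ L, G.IsHamList L := by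
  classical
  set M := y :: T ++ [x] with hM
  have hlen : M.length = T.length + 2 := by simp [hM]
  have hch' := List.isChain_iff_getElem.mp hch
  have hfirst : M[0]'(by omega) = y := by simp [hM]
  have hlast : M[T.length + 1]'(by omega) = x := by simp [hM]
  have hidx : ∀ w, ∃ i, ∃ h : i < M.length, M[i] = w := fun w => List.getElem_of_mem (hmem w)
  choose f hf hfw using hidx
  let R := Finset.range (T.length + 1)
  let g : ℕ → V := fun i => if h : i < M.length then M[i] else x
  have hg : ∀ i (h : i < M.length), g i = M[i] := fun i h => by simp [g, h]
  have hgf : ∀ w, g (f w) = w := fun w => by rw [hg _ (hf w), hfw]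
  have hinj : ∀ i j, i < M.length → j < M.length → g i = g j → i = j := by
    intro i j hi hj h
    rw [hg i hi, hg j hj, hnd.getElem_inj_iff] at h
    exact h
  -- Ore's crossing argument: an index in both sets gives edges from `x` to `M[i]` and from `y` to
  -- `M[i + 1]`.
  let J1 := R.filter fun i => g i ∈ G.nbrsIn x X
  let J2 := R.filter fun i => g (i + 1) ∈ G.nbrsIn y X
  have c1 : (G.nbrsIn x X).card ≤ J1.card := by
    refine Finset.card_le_card_of_injOn f ?_ ?_
    · intro w hw
      have hw' := hw
      simp only [Finset.mem_coe, mem_nbrsIn] at hw'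
      simp only [J1, R, Finset.coe_filter, Finset.mem_range, Set.mem_ofPred_eq, hgf]
      refine ⟨?_, hw⟩
      have := hf w
      have hne : f w ≠ T.length + 1 := by
        intro h
        have h1 := hgf w
        rw [h, hg _ (by omega), hlast] at h1
        exact G.irrefl (h1 ▸ hw'.2)
      omega
    · intro a _ b _ hab
      rw [← hgf a, ← hgf b, hab]
  have c2 : (G.nbrsIn y X).card ≤ J2.card := by
    refine Finset.card_le_card_of_injOn (fun w => f w - 1) ?_ ?_
    · intro w hw
      have hw' := hw
      simp only [Finset.mem_coe, mem_nbrsIn] at hw'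
      have hne : f w ≠ 0 := by
        intro h
        have h1 := hgf w
        rw [h, hg _ (by omega), hfirst] at h1
        exact G.irrefl (h1 ▸ hw'.2)
      have h2 : f w - 1 + 1 = f w := by omega
      have := hf w
      simp only [J2, R, Finset.coe_filter, Finset.mem_range, Set.mem_ofPred_eq, h2, hgf]
      exact ⟨by omega, hw⟩
    · have hne : ∀ w ∈ G.nbrsIn y X, f w ≠ 0 := by
        intro w hw h
        have h1 := hgf w
        rw [h, hg _ (by omega), hfirst] at h1
        exact G.irrefl (h1 ▸ (mem_nbrsIn.1 hw).2)
      intro a ha b hb hab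
      have h1 := hne a ha
      have h2 := hne b hb
      have h3 : f a = f b := by
        simp only at hab
        omega
      rw [← hgf a, ← hgf b, h3]
  -- An index in the union points at a vertex of `X` other than the last vertex `x`, or at a vertex
  -- outside `X` whose successor is in `X`, hence at a vertex of `Y`. The `erase` supplies the one
  -- unit that forces an overlap.
  have c3 : (J1 ∪ J2).card ≤ (X.erase x).card + Y.card := by
    refine (Finset.card_le_card_of_injOn g (t := X.erase x ∪ Y) ?_ ?_).trans (Finset.card_union_le _ _)
    · intro i hi
      have hiR : i < T.length + 1 := by
        simp only [J1, J2, R, Finset.coe_union, Finset.coe_filter, Set.mem_union,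
          Set.mem_ofPred_eq, Finset.mem_range] at hi
        omega
      rw [Finset.mem_coe, Finset.mem_union, Finset.mem_erase]
      by_cases hiX : g i ∈ X
      · refine Or.inl ⟨?_, hiX⟩
        intro h
        rw [← hlast, ← hg _ (by omega)] at h
        have := hinj _ _ (by omega) (by omega) h
        omega
      · right
        have hi2 : g (i + 1) ∈ X := by
          simp only [J1, J2, R, Finset.coe_union, Finset.coe_filter, Set.mem_union,
            Set.mem_ofPred_eq, mem_nbrsIn] at hi
          tauto
        refine hY _ _ hiX hi2 ?_
        rw [hg i (by omega), hg (i + 1) (by omega)]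
        exact hch' i (by omega)
    · intro i hi j hj hij
      simp only [J1, J2, R, Finset.coe_union, Finset.coe_filter, Set.mem_union,
          Set.mem_ofPred_eq, Finset.mem_range] at hi hj
      exact hinj i j (by omega) (by omega) hij
  have hXpos : 0 < X.card := Finset.card_pos.2 ⟨x, hx⟩
  rw [Finset.card_erase_of_mem hx] at c3
  have c4 := Finset.card_union_add_card_inter J1 J2
  obtain ⟨i, hi⟩ : (J1 ∩ J2).Nonempty := by
    rw [← Finset.card_pos]
    omega
  simp only [J1, J2, R, Finset.mem_inter, Finset.mem_filter, Finset.mem_range, mem_nbrsIn] at hi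
  obtain ⟨⟨hiR, -, h1⟩, -, -, h2⟩ := hi
  rw [hg _ (by omega)] at h1 h2
  refine ⟨M.take (i + 1) ++ (M.drop (i + 1)).reverse, ?_, ?_, ?_, ?_⟩
  · have hp : (M.take (i + 1) ++ (M.drop (i + 1)).reverse).Perm M := by
      conv_rhs => rw [← List.take_append_drop (i + 1) M]
      exact (List.Perm.refl _).append (List.reverse_perm _)
    exact hp.nodup_iff.2 hnd
  · intro w
    have := hmem w
    rw [← List.take_append_drop (i + 1) M, List.mem_append] at this
    rwa [List.mem_append, List.mem_reverse]
  · refine List.IsChain.append (hch.take _) ?_ ?_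
    · rw [List.isChain_reverse]
      exact (hch.drop _).imp fun _ _ h => h.symm
    · intro a ha b hb
      have ha' : a = M[i] := by
        rw [List.getLast?_take, if_neg (by omega), Nat.add_sub_cancel,
          List.getElem?_eq_getElem (by omega), Option.some_or, Option.mem_def,
          Option.some.injEq] at ha
        exact ha.symm
      have hb' : b = x := by
        rw [List.head?_reverse, List.getLast?_drop, if_neg (by omega)] at hb
        rw [hM, List.getLast?_append, List.getLast?_singleton, Option.some_or, Option.mem_def,
          Option.some.injEq] at hb
        exact hb.symm
      rw [ha', hb']
      exact h1.symm
  · intro a ha b hb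
    have ha' : a = M[i + 1]'(by omega) := by
      rw [List.getLast?_append, List.getLast?_reverse, List.head?_drop,
        List.getElem?_eq_getElem (by omega)] at ha
      simpa using ha.symm
    have hb' : b = y := by
      simpa [hM] using hb.symm
    rw [ha', hb']
    exact h2.symm

/-- One step of the closure: either the new edge is not used, or removing it leaves a Hamiltonian
path between `u` and `v`, which the exchange argument closes up again. Degrees are counted only
inside `X`, at the price of the boundary `Y`. -/
lemma IsHamList.exists_of_sup_edge [DecidableEq V] {G : SimpleGraph V} {X Y : Finset V} {u v : V}
    {L : List V} (hL : (G ⊔ edge u v).IsHamList L) (hlen : 3 ≤ L.length)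
    (hu : u ∈ X) (hv : v ∈ X) (hY : ∀ a b, a ∉ X → b ∈ X → G.Adj a b → a ∈ Y)
    (hdeg : X.card + Y.card ≤ (G.nbrsIn u X).card + (G.nbrsIn v X).card) :
    ∃ L, G.IsHamList L := by
  rcases hL.of_sup_edge hlen with h | ⟨x, y, T, ⟨rfl, rfl⟩ | ⟨rfl, rfl⟩, hnd, hmem, hch⟩
  · exact ⟨_, h⟩
  · exact exists_isHamList_of_path hu hY hdeg hnd hmem hch
  · exact exists_isHamList_of_path hv hY (by omega) hnd hmem hch

lemma IsHamList.length_eq [Fintype V] {G : SimpleGraph V} {L : List V} (hL : G.IsHamList L) :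
    L.length = Fintype.card V := by
  classical
  rw [← List.toFinset_card_of_nodup hL.nodup, ← Finset.card_univ]
  congr 1
  ext v
  simp [hL.mem v]

/-- If all degrees inside `X` are large, making `X` complete does not affect Hamiltonicity. -/
lemma exists_isHamList_of_sup_clique [Fintype V] [DecidableEq V] {G : SimpleGraph V}
    {X Y : Finset V} (hV : 3 ≤ Fintype.card V)
    (hY : ∀ a b, a ∉ X → b ∈ X → G.Adj a b → a ∈ Y)
    (hdeg : ∀ u ∈ X, X.card + Y.card ≤ 2 * (G.nbrsIn u X).card)
    (h : ∃ L, (G ⊔ fromEdgeSet (X.sym2 : Set (Sym2 V))).IsHamList L) : ∃ L, G.IsHamList L := by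
  -- The edges are added one at a time. They stay inside `X`, so the boundary condition persists
  -- while the degrees only grow.
  have key : ∀ E : Finset (Sym2 V), E ⊆ X.sym2 →
      (∃ L, (G ⊔ fromEdgeSet (E : Set (Sym2 V))).IsHamList L) → ∃ L, G.IsHamList L := by
    intro E
    induction E using Finset.induction_on with
    | empty =>
      rintro - ⟨L, hL⟩
      exact ⟨L, by simpa using hL⟩
    | insert e E he ih =>
      rintro hE ⟨L, hL⟩
      have hE' : E ⊆ X.sym2 := fun x hx => hE (Finset.mem_insert_of_mem hx)
      apply ih hE'
      induction e using Sym2.ind with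
      | _ u v =>
      have huv : u ∈ X ∧ v ∈ X := by
        have := hE (Finset.mem_insert_self _ _)
        simpa using this
      have heq : G ⊔ fromEdgeSet ((insert s(u, v) E : Finset (Sym2 V)) : Set (Sym2 V)) =
          (G ⊔ fromEdgeSet (E : Set (Sym2 V))) ⊔ edge u v := by
        ext a b
        simp only [Finset.coe_insert, sup_adj, fromEdgeSet_adj, Set.mem_insert_iff, edge_adj,
          Sym2.eq_iff]
        tauto
      rw [heq] at hL
      refine hL.exists_of_sup_edge (X := X) (Y := Y) (by rw [hL.length_eq]; exact hV)
        huv.1 huv.2 ?_ ?_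
      · intro a b ha hb hab
        rw [sup_adj, fromEdgeSet_adj] at hab
        rcases hab with hab | ⟨hab, -⟩
        · exact hY a b ha hb hab
        · have := hE' hab
          simp only [Finset.mk_mem_sym2_iff] at this
          exact absurd this.1 ha
      · have h1 := Finset.card_le_card
          (nbrsIn_mono (le_sup_left : G ≤ G ⊔ fromEdgeSet (E : Set (Sym2 V))) (v := u)
            (Finset.Subset.refl X))
        have h2 := Finset.card_le_card
          (nbrsIn_mono (le_sup_left : G ≤ G ⊔ fromEdgeSet (E : Set (Sym2 V))) (v := v)
            (Finset.Subset.refl X))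
        have h3 := hdeg u huv.1
        have h4 := hdeg v huv.2
        omega
  exact key _ (Finset.Subset.refl _) h

/-! ### Assembling a Hamiltonian cycle from two cliques -/

/-- A path of `G`, possibly empty, whose ends lie in `A`. -/
structure IsBlock (G : SimpleGraph V) (A : Finset V) (L : List V) : Prop where
  chain : L.IsChain G.Adj
  head : ∀ x ∈ L.head?, x ∈ A
  last : ∀ x ∈ L.getLast?, x ∈ A

lemma IsBlock.nil {G : SimpleGraph V} {A : Finset V} : G.IsBlock A [] :=
  ⟨List.IsChain.nil, by simp, by simp⟩

lemma IsBlock.singleton {G : SimpleGraph V} {A : Finset V} {x : V} (hx : x ∈ A) :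
    G.IsBlock A [x] :=
  ⟨List.isChain_singleton x, by simpa using hx, by simpa using hx⟩

lemma IsBlock.append {G : SimpleGraph V} {A : Finset V} {L M : List V}
    (hA : (A : Set V).Pairwise G.Adj)
    (hL : G.IsBlock A L) (hM : G.IsBlock A M) (hd : L.Disjoint M) : G.IsBlock A (L ++ M) := by
  refine ⟨hL.chain.append hM.chain ?_, ?_, ?_⟩
  · intro x hx y hy
    refine hA (hL.last x hx) (hM.head y hy) ?_
    rintro rfl
    exact hd (List.mem_of_getLast? hx) (List.mem_of_head? hy)
  · intro x hx
    rw [List.head?_append] at hx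
    cases h : L.head? with
    | none => exact hM.head x (by simpa [h] using hx)
    | some y => exact hL.head x (by simpa [h] using hx)
  · intro x hx
    rw [List.getLast?_append] at hx
    cases h : M.getLast? with
    | none => exact hL.last x (by simpa [h] using hx)
    | some y => exact hM.last x (by simpa [h] using hx)

lemma isBlock_of_nodup {G : SimpleGraph V} {A : Finset V} (hA : (A : Set V).Pairwise G.Adj) :
    ∀ L : List V, L.Nodup → (∀ x ∈ L, x ∈ A) → G.IsBlock A L
  | [], _, _ => IsBlock.nil
  | x :: L, hnd, hL => by
    rw [List.nodup_cons] at hnd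
    refine IsBlock.append hA (IsBlock.singleton (hL x (by simp)))
      (isBlock_of_nodup hA L hnd.2 fun y hy => hL y (by simp [hy])) ?_
    simpa using hnd.1

/-- Vertices with many neighbours in the cliques `A` and `B` can be absorbed into paths with ends
in one of the cliques. -/
lemma exists_isBlock_pair [DecidableEq V] {G : SimpleGraph V} {A B : Finset V}
    (hA : (A : Set V).Pairwise G.Adj) (hB : (B : Set V).Pairwise G.Adj) (hAB : Disjoint A B) :
    ∀ T Z : Finset V, Disjoint T A → Disjoint T B →
      (∀ s ∈ T, 2 * T.card + 1 ≤ (G.nbrsIn s ((A ∪ B) \ Z)).card) →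
      ∃ LA LB : List V, (LA ++ LB).Nodup ∧ G.IsBlock A LA ∧ G.IsBlock B LB ∧
        (∀ v ∈ LA, v ∈ T ∨ v ∈ A \ Z) ∧ (∀ v ∈ LB, v ∈ T ∨ v ∈ B \ Z) ∧
        ∀ s ∈ T, s ∈ LA ++ LB := by
  intro T
  induction T using Finset.induction_on with
  | empty => exact fun Z _ _ _ => ⟨[], [], by simp, .nil, .nil, by simp, by simp, by simp⟩
  | insert s T hs ih =>
    intro Z hTA hTB hdeg
    rw [Finset.disjoint_insert_left] at hTA hTB
    have hs1 := hdeg s (Finset.mem_insert_self _ _)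
    rw [Finset.card_insert_of_notMem hs] at hs1 hdeg
    have hsplit : G.nbrsIn s ((A ∪ B) \ Z) = G.nbrsIn s (A \ Z) ∪ G.nbrsIn s (B \ Z) := by
      ext v
      simp only [mem_nbrsIn, Finset.mem_sdiff, Finset.mem_union]
      tauto
    have hc := Finset.card_union_le (G.nbrsIn s (A \ Z)) (G.nbrsIn s (B \ Z))
    rw [← hsplit] at hc
    -- Absorbing `s` consumes two clique vertices, which the bound 2|T| + 1 pays for exactly.
    have hrec : ∀ u w : V, u ≠ w → ∀ t ∈ T,
        2 * T.card + 1 ≤ (G.nbrsIn t ((A ∪ B) \ (Z ∪ {u, w}))).card := by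
      intro u w huw t ht
      have h1 := hdeg t (Finset.mem_insert_of_mem ht)
      have h2 : G.nbrsIn t ((A ∪ B) \ Z) ⊆ G.nbrsIn t ((A ∪ B) \ (Z ∪ {u, w})) ∪ {u, w} := by
        intro v
        simp only [mem_nbrsIn, Finset.mem_sdiff, Finset.mem_union, Finset.mem_insert,
          Finset.mem_singleton]
        tauto
      have h3 := (Finset.card_le_card h2).trans (Finset.card_union_le _ _)
      have h4 : ({u, w} : Finset V).card = 2 := Finset.card_pair huw
      omega
    have hTs : ∀ t ∈ T, t ∉ A ∧ t ∉ B := fun t ht =>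
      ⟨Finset.disjoint_left.1 hTA.2 ht, Finset.disjoint_left.1 hTB.2 ht⟩
    have hdAB : ∀ v, v ∈ A → v ∉ B := fun v hv => Finset.disjoint_left.1 hAB hv
    -- At least three free neighbours are available, so two lie in the same clique and `u, s, w` is
    -- a block there.
    rcases (by omega : 2 ≤ (G.nbrsIn s (A \ Z)).card ∨ 2 ≤ (G.nbrsIn s (B \ Z)).card) with h | h
    · obtain ⟨u, hu, w, hw, huw⟩ := Finset.one_lt_card.1 h
      obtain ⟨LA, LB, h1, h2, h3, h4, h5, h6⟩ := ih (Z ∪ {u, w}) hTA.2 hTB.2 (hrec u w huw)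
      simp only [mem_nbrsIn, Finset.mem_sdiff, Finset.mem_union, Finset.mem_insert,
          Finset.mem_singleton] at hu hw h4 h5 ⊢
      have hd : ∀ v ∈ [u, s, w], v ∉ LA ∧ v ∉ LB := by
        intro v hv
        simp only [List.mem_cons, List.not_mem_nil, or_false] at hv
        refine ⟨fun hv' => ?_, fun hv' => ?_⟩
        · have := h4 v hv'
          rcases hv with rfl | rfl | rfl
          · have := hTs v; tauto
          · tauto
          · have := hTs v; tauto
        · have := h5 v hv'
          rcases hv with rfl | rfl | rfl
          · have := hTs v; have := hdAB v; tauto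
          · tauto
          · have := hTs v; have := hdAB v; tauto
      have hblk : G.IsBlock A [u, s, w] := by
        refine ⟨?_, by simpa using hu.1.1, by simpa using hw.1.1⟩
        simp [hu.2.symm, hw.2]
      refine ⟨[u, s, w] ++ LA, LB, ?_, hblk.append hA h2 ?_, h3, ?_, ?_, ?_⟩
      · rw [List.append_assoc, List.nodup_append']
        refine ⟨?_, h1, ?_⟩
        · simp [huw, hu.2.ne', hw.2.ne]
        · intro v hv hv'
          have := hd v hv
          rw [List.mem_append] at hv'
          tauto
      · intro v hv hv'
        exact (hd v hv).1 hv'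
      · intro v hv
        simp only [List.mem_append, List.mem_cons, List.not_mem_nil, or_false] at hv
        rcases hv with (rfl | rfl | rfl) | hv
        · exact Or.inr hu.1
        · exact Or.inl (Or.inl rfl)
        · exact Or.inr hw.1
        · have := h4 v hv
          tauto
      · intro v hv
        have := h5 v hv
        tauto
      · intro t ht
        rcases ht with rfl | ht
        · simp
        · have := h6 t ht
          simp only [List.mem_append] at this ⊢
          tauto
    · obtain ⟨u, hu, w, hw, huw⟩ := Finset.one_lt_card.1 h
      obtain ⟨LA, LB, h1, h2, h3, h4, h5, h6⟩ := ih (Z ∪ {u, w}) hTA.2 hTB.2 (hrec u w huw)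
      simp only [mem_nbrsIn, Finset.mem_sdiff, Finset.mem_union, Finset.mem_insert,
          Finset.mem_singleton] at hu hw h4 h5 ⊢
      have hd : ∀ v ∈ [u, s, w], v ∉ LA ∧ v ∉ LB := by
        intro v hv
        simp only [List.mem_cons, List.not_mem_nil, or_false] at hv
        refine ⟨fun hv' => ?_, fun hv' => ?_⟩
        · have := h4 v hv'
          rcases hv with rfl | rfl | rfl
          · have := hTs v; have := hdAB v; tauto
          · tauto
          · have := hTs v; have := hdAB v; tauto
        · have := h5 v hv'
          rcases hv with rfl | rfl | rfl
          · have := hTs v; tauto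
          · tauto
          · have := hTs v; tauto
      have hblk : G.IsBlock B [u, s, w] := by
        refine ⟨?_, by simpa using hu.1.1, by simpa using hw.1.1⟩
        simp [hu.2.symm, hw.2]
      refine ⟨LA, [u, s, w] ++ LB, ?_, h2, hblk.append hB h3 ?_, ?_, ?_, ?_⟩
      · have hp : (LA ++ ([u, s, w] ++ LB)).Perm ([u, s, w] ++ (LA ++ LB)) := by
          rw [← List.append_assoc, ← List.append_assoc]
          exact List.perm_append_comm.append_right _
        rw [hp.nodup_iff, List.nodup_append']
        refine ⟨?_, h1, ?_⟩
        · simp [huw, hu.2.ne', hw.2.ne]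
        · intro v hv hv'
          have := hd v hv
          rw [List.mem_append] at hv'
          tauto
      · intro v hv hv'
        exact (hd v hv).2 hv'
      · intro v hv
        have := h4 v hv
        tauto
      · intro v hv
        simp only [List.mem_append, List.mem_cons, List.not_mem_nil, or_false] at hv
        rcases hv with (rfl | rfl | rfl) | hv
        · exact Or.inr hu.1
        · exact Or.inl (Or.inl rfl)
        · exact Or.inr hw.1
        · have := h5 v hv
          tauto
      · intro t ht
        rcases ht with rfl | ht
        · simp
        · have := h6 t ht
          simp only [List.mem_append] at this ⊢
          tauto

/-- In a clique, a block extends to a path through the whole clique with prescribed ends. -/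
lemma exists_isChain_of_isBlock [DecidableEq V] {G : SimpleGraph V} {A : Finset V}
    (hA : (A : Set V).Pairwise G.Adj) {L : List V} (hL : G.IsBlock A L) (hnd : L.Nodup)
    {p p' : V} (hp : p ∈ A) (hp' : p' ∈ A) (hpp : p ≠ p') (hpL : p ∉ L) (hpL' : p' ∉ L) :
    ∃ M, (p :: M ++ [p']).Nodup ∧ (p :: M ++ [p']).IsChain G.Adj ∧
      ∀ v, v ∈ p :: M ++ [p'] ↔ v ∈ A ∨ v ∈ L := by
  set R := ((A \ {p, p'}).filter fun v => v ∉ L).toList with hR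
  have mR : ∀ v, v ∈ R ↔ (v ∈ A ∧ v ≠ p ∧ v ≠ p') ∧ v ∉ L := by
    intro v; simp [hR]
  have dR : R.Nodup := Finset.nodup_toList _
  have d2 : L.Disjoint R := fun v hv hv' => ((mR v).1 hv').2 hv
  have d1 : [p].Disjoint (L ++ R) := by
    intro v hv hv'
    rw [List.mem_singleton] at hv
    subst hv
    rw [List.mem_append, mR] at hv'
    tauto
  have d3 : ([p] ++ (L ++ R)).Disjoint [p'] := by
    intro v hv hv'
    rw [List.mem_singleton] at hv'
    subst hv'
    rw [List.mem_append, List.mem_append, mR, List.mem_singleton] at hv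
    have := hpp.symm
    tauto
  refine ⟨L ++ R, ?_, ?_, ?_⟩
  · change ([p] ++ (L ++ R) ++ [p']).Nodup
    exact List.nodup_append'.2 ⟨List.nodup_append'.2 ⟨by simp,
      List.nodup_append'.2 ⟨hnd, dR, d2⟩, d1⟩, by simp, d3⟩
  · exact (((IsBlock.singleton hp).append hA (hL.append hA
      (isBlock_of_nodup hA R dR fun v hv => ((mR v).1 hv).1.1) d2) d1).append hA
      (IsBlock.singleton hp') d3).chain
  · intro v
    simp only [List.cons_append, List.mem_cons, List.mem_append, List.not_mem_nil, or_false, mR]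
    by_cases e1 : v = p
    · subst e1; tauto
    by_cases e2 : v = p'
    · subst e2; tauto
    tauto

/-- Two cliques joined by two disjoint crossing paths, together with absorbable vertices,
span a Hamiltonian cycle. -/
lemma exists_isHamList_of_cliques [DecidableEq V] {G : SimpleGraph V} {A B S : Finset V}
    (hA : (A : Set V).Pairwise G.Adj) (hB : (B : Set V).Pairwise G.Adj) (hAB : Disjoint A B)
    (hSA : Disjoint S A) (hSB : Disjoint S B) (hcov : ∀ v, v ∈ A ∨ v ∈ B ∨ v ∈ S)
    {p p' q q' : V} (hp : p ∈ A) (hp' : p' ∈ A) (hq : q ∈ B) (hq' : q' ∈ B)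
    (hpp : p ≠ p') (hqq : q ≠ q') {C C' : List V} (hC : ∀ v ∈ C, v ∈ S) (hC' : ∀ v ∈ C', v ∈ S)
    (hnd : (C ++ C').Nodup) (hch : (q :: C ++ [p]).IsChain G.Adj)
    (hch' : (p' :: C' ++ [q']).IsChain G.Adj)
    (habs : ∀ s ∈ S, s ∉ C → s ∉ C' → 2 * S.card + 5 ≤ (G.nbrsIn s (A ∪ B)).card) :
    ∃ L, G.IsHamList L := by
  classical
  set T := S.filter fun s => s ∉ C ++ C' with hT
  have hTS : T ⊆ S := Finset.filter_subset _ _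
  -- The four path ends are withheld from absorption; this is the 4 in the bound 2|S| + 5 = (2|S| +
  -- 1) + 4.
  obtain ⟨LA, LB, h1, h2, h3, h4, h5, h6⟩ := exists_isBlock_pair hA hB hAB T {p, p', q, q'}
    (Finset.disjoint_of_subset_left hTS hSA) (Finset.disjoint_of_subset_left hTS hSB) (by
      intro s hs
      rw [hT, Finset.mem_filter, List.mem_append, not_or] at hs
      have e1 := habs s hs.1 hs.2.1 hs.2.2
      have e2 := Finset.card_le_card hTS
      have e3 : G.nbrsIn s (A ∪ B) ⊆ G.nbrsIn s ((A ∪ B) \ {p, p', q, q'}) ∪ {p, p', q, q'} := by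
        intro v
        simp only [mem_nbrsIn, Finset.mem_sdiff, Finset.mem_union]
        tauto
      have e4 := (Finset.card_le_card e3).trans (Finset.card_union_le _ _)
      have e5 : ({p, p', q, q'} : Finset V).card ≤ 4 := Finset.card_le_four
      omega)
  have mT : ∀ v, v ∈ T ↔ v ∈ S ∧ v ∉ C ∧ v ∉ C' := by
    intro v; simp [hT]
  simp only [Finset.mem_sdiff, Finset.mem_insert, Finset.mem_singleton, not_or, mT] at h4 h5
  have xSA : ∀ v, v ∈ S → v ∉ A := fun v hv => Finset.disjoint_left.1 hSA hv
  have xSB : ∀ v, v ∈ S → v ∉ B := fun v hv => Finset.disjoint_left.1 hSB hv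
  have xAB : ∀ v, v ∈ A → v ∉ B := fun v hv => Finset.disjoint_left.1 hAB hv
  have hndC := List.nodup_append'.1 hnd
  have hndL := List.nodup_append'.1 h1
  obtain ⟨MA, nA, cA, mA⟩ := exists_isChain_of_isBlock hA h2 hndL.1 hp hp' hpp
    (fun h => by have := h4 p h; have := xSA p; tauto)
    (fun h => by have := h4 p' h; have := xSA p'; tauto)
  obtain ⟨MB, nB, cB, mB⟩ := exists_isChain_of_isBlock hB h3 hndL.2.1 hq' hq hqq.symm
    (fun h => by have := h5 q' h; have := xSB q'; tauto)
    (fun h => by have := h5 q h; have := xSB q; tauto)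
  -- The vertex `p` is repeated at the end, so that splitting it off yields both the chain and its
  -- closing edge.
  have chain : (((p :: MA ++ [p']) ++ C' ++ (q' :: MB ++ [q]) ++ C) ++ [p]).IsChain G.Adj := by
    have k1 : ((p :: MA) ++ [p'] ++ (C' ++ [q'])).IsChain G.Adj :=
      cA.append_overlap (by simpa using hch') (by simp)
    have k2 : ((q' :: MB) ++ [q] ++ (C ++ [p])).IsChain G.Adj :=
      cB.append_overlap (by simpa using hch) (by simp)
    have k3 := List.IsChain.append_overlap (l₁ := p :: MA ++ [p'] ++ C') (l₂ := [q'])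
      (l₃ := MB ++ [q] ++ (C ++ [p])) (by simpa using k1) (by simpa using k2) (by simp)
    simpa using k3
  rw [List.isChain_append] at chain
  have rA : ∀ v, v ∈ p :: MA ++ [p'] → v ∈ A ∨ v ∈ S ∧ v ∉ C ∧ v ∉ C' ∧ v ∈ LA := by
    intro v hv
    rw [mA] at hv
    have := h4 v
    tauto
  have rB : ∀ v, v ∈ q' :: MB ++ [q] → v ∈ B ∨ v ∈ S ∧ v ∉ C ∧ v ∉ C' ∧ v ∈ LB := by
    intro v hv
    rw [mB] at hv
    have := h5 v
    tauto
  have dAC : ∀ v, v ∈ p :: MA ++ [p'] → v ∉ C ∧ v ∉ C' := by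
    intro v hv
    rcases rA v hv with h | h
    · exact ⟨fun h' => xSA v (hC v h') h, fun h' => xSA v (hC' v h') h⟩
    · exact ⟨h.2.1, h.2.2.1⟩
  have dBC : ∀ v, v ∈ q' :: MB ++ [q] → v ∉ C ∧ v ∉ C' := by
    intro v hv
    rcases rB v hv with h | h
    · exact ⟨fun h' => xSB v (hC v h') h, fun h' => xSB v (hC' v h') h⟩
    · exact ⟨h.2.1, h.2.2.1⟩
  have dAB : ∀ v, v ∈ p :: MA ++ [p'] → v ∉ q' :: MB ++ [q] := by
    intro v hv hv'
    rcases rA v hv with h | h <;> rcases rB v hv' with h' | h'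
    · exact xAB v h h'
    · exact xSA v h'.1 h
    · exact xSB v h.1 h'
    · exact hndL.2.2 h.2.2.2 h'.2.2.2
  refine ⟨_, ?_, ?_, chain.1, ?_⟩
  · refine List.nodup_append'.2 ⟨List.nodup_append'.2 ⟨List.nodup_append'.2
      ⟨nA, hndC.2.1, fun v hv hv' => (dAC v hv).2 hv'⟩, nB, ?_⟩, hndC.1, ?_⟩
    · intro v hv hv'
      rcases List.mem_append.1 hv with h | h
      · exact dAB v h hv'
      · exact (dBC v hv').2 h
    · intro v hv hv'
      rcases List.mem_append.1 hv with h | h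
      · rcases List.mem_append.1 h with h | h
        · exact (dAC v h).1 hv'
        · exact hndC.2.2 hv' h
      · exact (dBC v h).1 hv'
  · intro v
    rw [List.mem_append, List.mem_append, List.mem_append, mA, mB]
    by_cases hvT : v ∈ T
    · have := List.mem_append.1 (h6 v hvT)
      tauto
    · rw [mT] at hvT
      have := hcov v
      tauto
  · intro x hx y hy
    exact chain.2.2 x hx y (by simpa using hy)

/-- A graph consisting of two dense parts `A`, `B` joined by two disjoint crossing paths,
and few other vertices, has a Hamiltonian cycle. -/
lemma exists_isHamList_of_crossing [Fintype V] [DecidableEq V] {G : SimpleGraph V}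
    {A B S : Finset V} (hV : 3 ≤ Fintype.card V) (hAB : Disjoint A B)
    (hSA : Disjoint S A) (hSB : Disjoint S B) (hcov : ∀ v, v ∈ A ∨ v ∈ B ∨ v ∈ S)
    {p p' q q' : V} (hp : p ∈ A) (hp' : p' ∈ A) (hq : q ∈ B) (hq' : q' ∈ B)
    (hpp : p ≠ p') (hqq : q ≠ q') {C C' : List V} (hC : ∀ v ∈ C, v ∈ S) (hC' : ∀ v ∈ C', v ∈ S)
    (hnd : (C ++ C').Nodup) (hch : (q :: C ++ [p]).IsChain G.Adj)
    (hch' : (p' :: C' ++ [q']).IsChain G.Adj)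
    (hcross : ∀ a ∈ A, ∀ b ∈ B, G.Adj a b → (a = p ∨ a = p') ∧ (b = q ∨ b = q'))
    (hdA : ∀ u ∈ A, A.card + S.card + 2 ≤ 2 * (G.nbrsIn u A).card)
    (hdB : ∀ u ∈ B, B.card + S.card + 2 ≤ 2 * (G.nbrsIn u B).card)
    (habs : ∀ s ∈ S, s ∉ C → s ∉ C' → 2 * S.card + 5 ≤ (G.nbrsIn s (A ∪ B)).card) :
    ∃ L, G.IsHamList L := by
  have hY : ∀ a b : V, (S ∪ {a, b}).card ≤ S.card + 2 := fun a b =>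
    (Finset.card_union_le _ _).trans (Nat.add_le_add_left Finset.card_le_two _)
  have xAB : ∀ v, v ∈ A → v ∉ B := fun v hv => Finset.disjoint_left.1 hAB hv
  -- The crossing edges meet `B` only in `q` and `q'`, so the boundary of `A` is within `S ∪ {q,
  -- q'}`. Completing `A` first adds nothing to the boundary of `B`.
  refine exists_isHamList_of_sup_clique (X := A) (Y := S ∪ {q, q'}) hV ?_
    (fun u hu => le_trans (by have := hY q q'; omega) (hdA u hu)) ?_
  · intro a b ha hb hab
    rcases hcov a with h | h | h
    · exact absurd h ha
    · have := (hcross b hb a h hab.symm).2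
      simpa [or_assoc] using this.elim Or.inl fun h => Or.inr (Or.inl h)
    · simp [h]
  refine exists_isHamList_of_sup_clique (X := B) (Y := S ∪ {p, p'}) hV ?_
    (fun u hu => le_trans (by have := hY p p'; omega) ((hdB u hu).trans
      (Nat.mul_le_mul_left 2 (Finset.card_le_card
        (nbrsIn_mono le_sup_left (Finset.Subset.refl B)))))) ?_
  · intro a b ha hb hab
    have hab' : G.Adj a b := by
      rw [sup_adj, fromEdgeSet_adj] at hab
      rcases hab with hab | ⟨hab, -⟩
      · exact hab
      · simp only [Finset.mem_coe, Finset.mk_mem_sym2_iff] at hab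
        exact absurd hb (xAB b hab.2)
    rcases hcov a with h | h | h
    · have := (hcross a h b hb hab').1
      simpa [or_assoc] using this.elim Or.inl fun h => Or.inr (Or.inl h)
    · exact absurd h ha
    · simp [h]
  set K := G ⊔ fromEdgeSet (A.sym2 : Set (Sym2 V)) ⊔ fromEdgeSet (B.sym2 : Set (Sym2 V)) with hK
  have hle : G ≤ K := le_sup_left.trans le_sup_left
  refine exists_isHamList_of_cliques (G := K) ?_ ?_ hAB hSA hSB hcov hp hp' hq hq' hpp hqq hC hC'
    hnd (hch.imp fun _ _ h => hle h) (hch'.imp fun _ _ h => hle h) fun s hs h1 h2 =>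
      (habs s hs h1 h2).trans (Finset.card_le_card (nbrsIn_mono hle (Finset.Subset.refl _)))
  · intro a ha b hb hab
    simp only [Finset.mem_coe] at ha hb
    simp [hK, hab, ha, hb]
  · intro a ha b hb hab
    simp only [Finset.mem_coe] at ha hb
    simp [hK, hab, ha, hb]

/-! ### From lists to walks; connectivity and separators -/

/-- A cyclic list of vertices yields a Hamiltonian cycle as a walk. -/
lemma IsHamList.exists_walk [Fintype V] [DecidableEq V] {G : SimpleGraph V} {L : List V}
    (hL : G.IsHamList L) (hV : 3 ≤ Fintype.card V) :
    ∃ (v : V) (W : G.Walk v v), W.IsHamiltonianCycle := by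
  have hlen := hL.length_eq
  rcases L with _ | ⟨x, L⟩
  · simp at hlen; omega
  set z := (x :: L).getLast (by simp) with hz
  have hlast : G.Adj z x := hL.close z (by simp [hz, List.getLast?_eq_some_getLast]) x (by simp)
  obtain ⟨P, hPs⟩ : ∃ P : G.Walk x z, P.support = x :: L :=
    ⟨Walk.ofSupport (x :: L) (by simp) hL.chain, Walk.support_ofSupport _ _⟩
  have hP : P.IsPath := by rw [Walk.isPath_def, hPs]; exact hL.nodup
  have hPl : P.length = Fintype.card V - 1 := by
    have := Walk.length_support P
    rw [hPs, hlen] at this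
    omega
  refine ⟨_, Walk.cons hlast P, ?_⟩
  rw [Walk.isHamiltonianCycle_iff_isCycle_and_length_eq]
  refine ⟨?_, by rw [Walk.length_cons, hPl]; omega⟩
  rw [Walk.cons_isCycle_iff]
  refine ⟨hP, fun he => ?_⟩
  -- A closing edge already on the path would make the path a single edge, which three vertices rule
  -- out.
  have h2 := hP.length_eq_one_of_mem_edges (Sym2.eq_swap ▸ he)
  omega

/-- With more than k vertices, the alternative of leaving at most one vertex already costs k
deletions, so only disconnecting sets matter. -/
lemma isKConnected_iff [Fintype V] {G : SimpleGraph V} {k : ℕ} (hk : k < Fintype.card V) :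
    G.IsKConnected k ↔
      ∀ T : Finset V, T.card < k → (G.induce {v : V | v ∉ T}).Connected := by
  have hne : {m : ℕ | ∃ S : Finset V, S.card = m ∧ (¬ (G.induce {v : V | v ∉ S}).Connected ∨
      Fintype.card V ≤ S.card + 1)}.Nonempty :=
    ⟨_, Finset.univ, rfl, Or.inr (by rw [Finset.card_univ]; omega)⟩
  constructor
  · intro h T hT
    by_contra hcon
    have := h.trans (Nat.sInf_le ⟨T, rfl, Or.inl hcon⟩)
    omega
  · intro h
    refine le_csInf hne ?_
    rintro m ⟨S, rfl, hS | hS⟩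
    · by_contra hlt
      exact hS (h S (by omega))
    · omega

/-- In a connected graph there is an edge leaving every nontrivial set. -/
lemma exists_adj_of_connected_induce {G : SimpleGraph V} {T : Set V}
    (h : (G.induce T).Connected) (X : Set V) {x y : V} (hxT : x ∈ T) (hyT : y ∈ T)
    (hx : x ∈ X) (hy : y ∉ X) : ∃ a ∈ X, ∃ b ∉ X, a ∈ T ∧ b ∈ T ∧ G.Adj a b := by
  obtain ⟨p⟩ := h.preconnected ⟨x, hxT⟩ ⟨y, hyT⟩
  obtain ⟨d, -, h1, h2⟩ := p.exists_boundary_dart (Subtype.val ⁻¹' X) hx hy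
  exact ⟨d.fst, h1, d.snd, h2, d.fst.2, d.snd.2, d.adj⟩

/-- A disconnected induced subgraph splits into two nonempty parts without edges between them. -/
lemma exists_split_of_not_connected [Fintype V] [DecidableEq V] {G : SimpleGraph V} {S : Finset V}
    (hS : S.card < Fintype.card V) (h : ¬ (G.induce {v : V | v ∉ S}).Connected) :
    ∃ A B : Finset V, A.Nonempty ∧ B.Nonempty ∧ Disjoint A B ∧ Disjoint S A ∧ Disjoint S B ∧
      (∀ v, v ∈ A ∨ v ∈ B ∨ v ∈ S) ∧ ∀ a ∈ A, ∀ b ∈ B, ¬ G.Adj a b := by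
  classical
  have hne : Nonempty {v : V | v ∉ S} := by
    by_contra hcon
    have : S = Finset.univ := by
      ext v
      simp only [Finset.mem_univ, iff_true]
      by_contra hv
      exact hcon ⟨⟨v, hv⟩⟩
    rw [this, Finset.card_univ] at hS
    exact lt_irrefl _ hS
  have hpre : ¬ (G.induce {v : V | v ∉ S}).Preconnected := fun hp => h ⟨hp⟩
  rw [Preconnected] at hpre
  push Not at hpre
  obtain ⟨x, y, hxy⟩ := hpre
  let P : V → Prop := fun v => ∃ hv : v ∉ S, (G.induce {v : V | v ∉ S}).Reachable x ⟨v, hv⟩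
  refine ⟨Finset.univ.filter P, Finset.univ.filter fun v => v ∉ S ∧ ¬ P v, ⟨x, ?_⟩, ⟨y, ?_⟩,
    ?_, ?_, ?_, ?_, ?_⟩
  · simp only [Finset.mem_filter, Finset.mem_univ, true_and, P]
    exact ⟨x.2, Reachable.refl _⟩
  · simp only [Finset.mem_filter, Finset.mem_univ, true_and, P]
    exact ⟨y.2, fun ⟨_, h⟩ => hxy h⟩
  · rw [Finset.disjoint_left]
    intro v hv hv'
    rw [Finset.mem_filter] at hv hv'
    exact hv'.2.2 hv.2
  · rw [Finset.disjoint_left]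
    intro v hv hv'
    rw [Finset.mem_filter] at hv'
    exact hv'.2.1 hv
  · rw [Finset.disjoint_left]
    intro v hv hv'
    rw [Finset.mem_filter] at hv'
    exact hv'.2.1 hv
  · intro v
    simp only [Finset.mem_filter, Finset.mem_univ, true_and]
    tauto
  · intro a ha b hb hab
    rw [Finset.mem_filter] at ha hb
    obtain ⟨-, ha1, ha2⟩ := ha
    refine hb.2.2 ⟨hb.2.1, ha2.trans (Adj.reachable ?_)⟩
    exact hab

/-! ### Degree bookkeeping under edge deletion -/

lemma nbrsIn_union [DecidableEq V] {G : SimpleGraph V} {v : V} {X Y : Finset V} :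
    G.nbrsIn v (X ∪ Y) = G.nbrsIn v X ∪ G.nbrsIn v Y := by
  ext w
  simp only [mem_nbrsIn, Finset.mem_union]
  tauto

lemma card_nbrsIn_union_le [DecidableEq V] {G : SimpleGraph V} {v : V} {X Y : Finset V} :
    (G.nbrsIn v (X ∪ Y)).card ≤ (G.nbrsIn v X).card + (G.nbrsIn v Y).card := by
  rw [nbrsIn_union]
  exact Finset.card_union_le _ _

lemma card_nbrsIn_le {G : SimpleGraph V} {v : V} {X : Finset V} :
    (G.nbrsIn v X).card ≤ X.card :=
  Finset.card_le_card fun _ hw => (mem_nbrsIn.1 hw).1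

lemma card_nbrsIn_le_deleteEdges [DecidableEq V] (G : SimpleGraph V) (E : Set (Sym2 V)) (v : V)
    (X : Finset V) :
    (G.nbrsIn v X).card ≤
      ((G.deleteEdges E).nbrsIn v X).card + ((fromEdgeSet E).nbrsIn v X).card := by
  refine (Finset.card_le_card ?_).trans (Finset.card_union_le _ _)
  intro w
  simp only [mem_nbrsIn, Finset.mem_union, deleteEdges_adj, fromEdgeSet_adj]
  rintro ⟨h1, h2⟩
  have := h2.ne
  tauto

lemma card_nbrsIn_fromEdgeSet_union_le [DecidableEq V] (E F : Set (Sym2 V)) (v : V)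
    (X : Finset V) : ((fromEdgeSet (E ∪ F)).nbrsIn v X).card ≤
      ((fromEdgeSet E).nbrsIn v X).card + ((fromEdgeSet F).nbrsIn v X).card := by
  refine (Finset.card_le_card ?_).trans (Finset.card_union_le _ _)
  intro w
  simp only [mem_nbrsIn, Finset.mem_union, fromEdgeSet_adj, Set.mem_union]
  tauto

lemma Walk.IsHamiltonianCycle.card_nbrsIn_le_two [DecidableEq V] {G : SimpleGraph V} {u : V}
    {W : G.Walk u u} (hW : W.IsHamiltonianCycle) (v : V) (X : Finset V) :
    ((fromEdgeSet W.edgeSet).nbrsIn v X).card ≤ 2 := by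
  rw [← hW.isCycle.ncard_neighborSet_toSubgraph_eq_two (hW.mem_support v),
    ← Set.ncard_coe_finset]
  refine Set.ncard_le_ncard ?_ (Walk.finite_neighborSet_toSubgraph W)
  intro w hw
  simp only [Finset.mem_coe, mem_nbrsIn, fromEdgeSet_adj, Walk.mem_edgeSet] at hw
  rw [Subgraph.mem_neighborSet, Walk.adj_toSubgraph_iff_mem_edges]
  exact hw.2.1

/-! ### Split graphs and robustness of their connectivity -/

/-- The vertex set of a graph of minimum degree at least `d` is split into two parts `A`, `B` with
few edges between them and a small rest `S`. -/
structure IsSplit [Fintype V] (G : SimpleGraph V) (k l d : ℕ) (A B S : Finset V) : Prop where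
  disjAB : Disjoint A B
  disjSA : Disjoint S A
  disjSB : Disjoint S B
  cover : ∀ v, v ∈ A ∨ v ∈ B ∨ v ∈ S
  crossA : ∀ a ∈ A, (G.nbrsIn a B).card ≤ 2
  crossB : ∀ b ∈ B, (G.nbrsIn b A).card ≤ 2
  neA : A.Nonempty
  neB : B.Nonempty
  cardS : S.card < k
  two_le_l : 2 ≤ l
  degree : ∀ v, d ≤ (G.nbrsIn v Finset.univ).card
  card_le : Fintype.card V ≤ 2 * d
  le_d : 3 * k + 4 * l + 1 ≤ d

namespace IsSplit

variable [Fintype V] {G : SimpleGraph V} {k l d : ℕ} {A B S : Finset V}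

lemma symm (h : G.IsSplit k l d A B S) : G.IsSplit k l d B A S where
  disjAB := h.disjAB.symm
  disjSA := h.disjSB
  disjSB := h.disjSA
  cover v := by have := h.cover v; tauto
  crossA := h.crossB
  crossB := h.crossA
  neA := h.neB
  neB := h.neA
  cardS := h.cardS
  two_le_l := h.two_le_l
  degree := h.degree
  card_le := h.card_le
  le_d := h.le_d

lemma card_add [DecidableEq V] (h : G.IsSplit k l d A B S) :
    A.card + B.card + S.card = Fintype.card V := by
  rw [← Finset.card_union_of_disjoint h.disjAB, ← Finset.card_union_of_disjoint,
    ← Finset.card_univ]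
  · congr 1
    ext v
    have := h.cover v
    simp only [Finset.mem_union, Finset.mem_univ, iff_true]
    tauto
  · exact Finset.disjoint_union_left.2 ⟨h.disjSA.symm, h.disjSB.symm⟩

lemma le_card_nbrsIn_add [DecidableEq V] (h : G.IsSplit k l d A B S) (v : V) :
    d ≤ (G.nbrsIn v A).card + (G.nbrsIn v B).card + (G.nbrsIn v S).card := by
  have h1 := h.degree v
  have h2 : (Finset.univ : Finset V) = A ∪ B ∪ S := by
    ext w
    have := h.cover w
    simp only [Finset.mem_union, Finset.mem_univ, true_iff]
    tauto
  rw [h2] at h1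
  have h3 := card_nbrsIn_union_le (G := G) (v := v) (X := A ∪ B) (Y := S)
  have h4 := card_nbrsIn_union_le (G := G) (v := v) (X := A) (Y := B)
  omega

lemma le_card_nbrsIn_of_mem [DecidableEq V] (h : G.IsSplit k l d A B S) {v : V} (hv : v ∈ A) :
    d ≤ (G.nbrsIn v A).card + S.card + 2 := by
  have h1 := h.le_card_nbrsIn_add v
  have h2 := h.crossA v hv
  have h3 := card_nbrsIn_le (G := G) (v := v) (X := S)
  omega

/-- A vertex of `S` is not its own neighbour, which gains one over the bound |S|. -/
lemma le_card_nbrsIn_of_mem_S [DecidableEq V] (h : G.IsSplit k l d A B S) {v : V} (hv : v ∈ S) :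
    d + 1 ≤ (G.nbrsIn v A).card + (G.nbrsIn v B).card + S.card := by
  have h1 := h.le_card_nbrsIn_add v
  have h3 : (G.nbrsIn v S).card ≤ (S.erase v).card := by
    refine Finset.card_le_card fun w hw => ?_
    rw [mem_nbrsIn] at hw
    exact Finset.mem_erase.2 ⟨hw.2.ne', hw.1⟩
  rw [Finset.card_erase_of_mem hv] at h3
  have : 0 < S.card := Finset.card_pos.2 ⟨v, hv⟩
  omega

lemma le_card_left [DecidableEq V] (h : G.IsSplit k l d A B S) : d ≤ A.card + S.card + 1 := by
  obtain ⟨v, hv⟩ := h.neA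
  have h1 := h.le_card_nbrsIn_of_mem hv
  have h3 : (G.nbrsIn v A).card ≤ (A.erase v).card := by
    refine Finset.card_le_card fun w hw => ?_
    rw [mem_nbrsIn] at hw
    exact Finset.mem_erase.2 ⟨hw.2.ne', hw.1⟩
  rw [Finset.card_erase_of_mem hv] at h3
  have : 0 < A.card := Finset.card_pos.2 ⟨v, hv⟩
  omega

/-- `B` and `S` together already take at least d - 1 of the at most 2d vertices. -/
lemma card_left_le [DecidableEq V] (h : G.IsSplit k l d A B S) : A.card ≤ d + 1 := by
  have h1 := h.card_add
  have h2 := h.symm.le_card_left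
  have h3 := h.card_le
  omega

/-- One side of a split stays connected after deleting edges of small degree and few vertices. -/
lemma reachable_left [DecidableEq V] (h : G.IsSplit k l d A B S) {G' : SimpleGraph V}
    (hG' : ∀ v, ∀ X : Finset V, (G.nbrsIn v X).card ≤ (G'.nbrsIn v X).card + 2 * l)
    {T : Finset V} (hT : T.card < k) {u v : V} (hu : k ≤ (G'.nbrsIn u A).card ∨ u ∈ A)
    (hv : k ≤ (G'.nbrsIn v A).card ∨ v ∈ A) (huT : u ∉ T) (hvT : v ∉ T) :
    (G'.induce {v : V | v ∉ T}).Reachable ⟨u, huT⟩ ⟨v, hvT⟩ := by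
  have hadj : ∀ x y : V, ∀ hx : x ∉ T, ∀ hy : y ∉ T, G'.Adj x y →
      (G'.induce {v : V | v ∉ T}).Reachable ⟨x, hx⟩ ⟨y, hy⟩ :=
    fun x y hx hy hxy => Adj.reachable hxy
  have hA : ∀ x y : V, ∀ hx : x ∉ T, ∀ hy : y ∉ T, x ∈ A → y ∈ A →
      (G'.induce {v : V | v ∉ T}).Reachable ⟨x, hx⟩ ⟨y, hy⟩ := by
    intro x y hx hy hxA hyA
    by_cases hxy : x = y
    · subst hxy; exact Reachable.refl _
    by_cases had : G'.Adj x y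
    · exact hadj x y hx hy had
    have hsub : G'.nbrsIn x A ∪ G'.nbrsIn y A ⊆ (A.erase x).erase y := by
      intro w hw
      simp only [Finset.mem_union, mem_nbrsIn] at hw
      simp only [Finset.mem_erase]
      refine ⟨?_, ?_, by tauto⟩
      · rintro rfl
        rcases hw with hw | hw
        · exact had hw.2
        · exact G'.irrefl hw.2
      · rintro rfl
        rcases hw with hw | hw
        · exact G'.irrefl hw.2
        · exact had hw.2.symm
    have h1 := Finset.card_le_card hsub
    rw [Finset.card_erase_of_mem (Finset.mem_erase.2 ⟨Ne.symm hxy, hyA⟩),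
      Finset.card_erase_of_mem hxA] at h1
    have h2 := Finset.card_union_add_card_inter (G'.nbrsIn x A) (G'.nbrsIn y A)
    have h3 := h.le_card_nbrsIn_of_mem hxA
    have h4 := h.le_card_nbrsIn_of_mem hyA
    have h5 := hG' x A
    have h6 := hG' y A
    have h7 := h.card_left_le
    have h8 := h.le_d
    have h9 := h.cardS
    have h10 : 1 < A.card := Finset.one_lt_card.2 ⟨x, hxA, y, hyA, hxy⟩
    -- Nonadjacent `x`, `y` have at least 2(d - |S| - 2 - 2l) - (|A| - 2) ≥ d - 2k - 4l - 1 ≥ k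
    -- common neighbours in `A`. Here d ≥ 3k + 4l + 1 is needed in full.
    obtain ⟨w, hw, hwT⟩ := Finset.exists_mem_notMem_of_card_lt_card
      (s := T) (t := G'.nbrsIn x A ∩ G'.nbrsIn y A) (by omega)
    rw [Finset.mem_inter, mem_nbrsIn, mem_nbrsIn] at hw
    exact (hadj x w hx hwT hw.1.2).trans (hadj w y hwT hy hw.2.2.symm)
  have hS : ∀ x : V, ∀ hx : x ∉ T, (k ≤ (G'.nbrsIn x A).card ∨ x ∈ A) →
      ∃ y, ∃ hy : y ∉ T, y ∈ A ∧ (G'.induce {v : V | v ∉ T}).Reachable ⟨x, hx⟩ ⟨y, hy⟩ := by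
    intro x hx hxA
    rcases hxA with hxA | hxA
    · obtain ⟨w, hw, hwT⟩ := Finset.exists_mem_notMem_of_card_lt_card
        (s := T) (t := G'.nbrsIn x A) (by omega)
      rw [mem_nbrsIn] at hw
      exact ⟨w, hwT, hw.1, hadj x w hx hwT hw.2⟩
    · exact ⟨x, hx, hxA, Reachable.refl _⟩
  obtain ⟨x, hx, hxA, hux⟩ := hS u huT hu
  obtain ⟨y, hy, hyA, hvy⟩ := hS v hvT hv
  exact (hux.trans (hA x y hx hy hxA hyA)).trans hvy.symm

/-- A split graph remains `k`-connected as long as a matching of size `k` between the two sides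
survives. -/
lemma isKConnected_of_matching [DecidableEq V] (h : G.IsSplit k l d A B S) {G' : SimpleGraph V}
    (hG' : ∀ v, ∀ X : Finset V, (G.nbrsIn v X).card ≤ (G'.nbrsIn v X).card + 2 * l)
    {P : Finset V} (hPA : ∀ v ∈ P, v ∈ A ∨ v ∈ S ∧ (G.nbrsIn v B).card ≤ (G.nbrsIn v A).card)
    (hPB : ∀ v ∉ P, v ∈ B ∨ v ∈ S ∧ (G.nbrsIn v A).card ≤ (G.nbrsIn v B).card)
    {M : Finset V} {f : V → V} (hM : k ≤ M.card) (hMP : M ⊆ P) (hf : Set.InjOn f M)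
    (hfP : ∀ u ∈ M, f u ∉ P ∧ G'.Adj u (f u)) : G'.IsKConnected k := by
  have hkV : k < Fintype.card V := by
    have h1 := h.card_add
    have h2 := h.le_card_left
    have h3 := h.le_d
    have h4 := h.cardS
    have h5 := h.two_le_l
    omega
  rw [isKConnected_iff hkV]
  intro T hT
  -- The larger half is at least k + 2l, so k neighbours survive the loss of 2l edges.
  have hmaj : ∀ v ∈ S, 2 * k + 4 * l ≤ (G.nbrsIn v A).card + (G.nbrsIn v B).card := by
    intro v hv
    have h1 := h.le_card_nbrsIn_of_mem_S hv
    have h3 := h.le_d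
    have h4 := h.cardS
    omega
  have hPA' : ∀ v ∈ P, k ≤ (G'.nbrsIn v A).card ∨ v ∈ A := by
    intro v hv
    rcases hPA v hv with h1 | ⟨h1, h2⟩
    · exact Or.inr h1
    · have := hmaj v h1
      have := hG' v A
      exact Or.inl (by omega)
  have hPB' : ∀ v ∉ P, k ≤ (G'.nbrsIn v B).card ∨ v ∈ B := by
    intro v hv
    rcases hPB v hv with h1 | ⟨h1, h2⟩
    · exact Or.inr h1
    · have := hmaj v h1
      have := hG' v B
      exact Or.inl (by omega)
  obtain ⟨u, huM, huT, hfT⟩ : ∃ u ∈ M, u ∉ T ∧ f u ∉ T := by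
    by_contra hcon
    push Not at hcon
    have : M.card ≤ T.card := by
      -- If `T` met every matching edge, choosing an end in `T` would inject the matching into `T`.
      refine Finset.card_le_card_of_injOn (fun u => if u ∈ T then u else f u) ?_ ?_
      · intro u hu
        simp only [Finset.mem_coe]
        split_ifs with h1
        · exact h1
        · exact hcon u hu h1
      · intro u hu v hv huv
        simp only at huv
        split_ifs at huv with h1 h2 h2
        · exact huv
        · exact absurd (huv ▸ hMP hu) (hfP v hv).1
        · exact absurd (huv ▸ hMP hv) (hfP u hu).1
        · exact hf hu hv huv
    omega
  have hadj : (G'.induce {v : V | v ∉ T}).Reachable ⟨u, huT⟩ ⟨f u, hfT⟩ :=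
    Adj.reachable (hfP u huM).2
  have hall : ∀ v, ∀ hv : v ∉ T, (G'.induce {v : V | v ∉ T}).Reachable ⟨v, hv⟩ ⟨u, huT⟩ := by
    intro v hv
    by_cases hvP : v ∈ P
    · exact h.reachable_left hG' hT (hPA' v hvP) (hPA' u (hMP huM)) hv huT
    · exact (h.symm.reachable_left hG' hT (hPB' v hvP) (hPB' (f u) (hfP u huM).1) hv hfT).trans
        hadj.symm
  have : Nonempty {v : V | v ∉ T} := ⟨⟨u, huT⟩⟩
  exact ⟨fun x y => (hall x.1 x.2).trans (hall y.1 y.2).symm⟩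

end IsSplit

/-! ### Matchings across a cut, and iterated choice of cycles -/

/-- In a `k`-connected graph there is a matching of size `k` between any two complementary sets of
at least `k` vertices. -/
lemma IsKConnected.exists_matching [Fintype V] [DecidableEq V] {G : SimpleGraph V} {k : ℕ}
    (hG : G.IsKConnected k) (P : Finset V) (hP : k ≤ P.card) (hP' : k ≤ (Pᶜ).card)
    (hV : k < Fintype.card V) :
    ∃ (M : Finset V) (f : V → V), M.card = k ∧ M ⊆ P ∧ Set.InjOn f M ∧
      ∀ u ∈ M, f u ∉ P ∧ G.Adj u (f u) := by
  classical
  rw [isKConnected_iff hV] at hG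
  -- Every vertex of `P` is also joined to |P| - k dummy vertices. A transversal then uses real
  -- neighbours for at least k vertices.
  let t : P → Finset (V ⊕ Fin (P.card - k)) := fun u =>
    (G.nbrsIn u Pᶜ).disjSum Finset.univ
  have hall : ∀ X : Finset P, X.card ≤ (X.biUnion t).card := by
    intro X
    rcases X.eq_empty_or_nonempty with rfl | ⟨x, hx⟩
    · simp
    let N := X.biUnion fun u => G.nbrsIn u Pᶜ
    have hN : X.biUnion t = N.disjSum Finset.univ := by
      ext w
      rcases w with w | w
      · simp [t, N]
      · simp only [Finset.mem_biUnion, Finset.inr_mem_disjSum, Finset.mem_univ, t, iff_true]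
        exact ⟨x, hx, trivial⟩
    rw [hN, Finset.card_disjSum, Finset.card_univ, Fintype.card_fin]
    by_contra hcon
    let X' : Finset V := X.map (Function.Embedding.subtype _)
    have hX' : X'.card = X.card := Finset.card_map _
    have hX'P : X' ⊆ P := by
      intro w hw
      simp only [X', Finset.mem_map, Function.Embedding.subtype_apply] at hw
      obtain ⟨a, -, rfl⟩ := hw
      exact a.2
    have hNP : N ⊆ Pᶜ := by
      intro w hw
      simp only [N, Finset.mem_biUnion, mem_nbrsIn] at hw
      obtain ⟨a, -, hw, -⟩ := hw
      exact hw
    have hXP := Finset.card_le_card hX'P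
    -- If Hall's condition fails at `X'`, the set `(P \ X') ∪ N` has fewer than k elements, yet it
    -- cuts `X'` off from the nonempty rest of `Pᶜ`.
    have hT : ((P \ X') ∪ N).card < k := by
      have h1 := Finset.card_union_le (P \ X') N
      rw [Finset.card_sdiff_of_subset hX'P] at h1
      omega
    obtain ⟨y, hy, hyN⟩ := Finset.exists_mem_notMem_of_card_lt_card
      (s := N) (t := Pᶜ) (by omega)
    rw [Finset.mem_compl] at hy
    have hxX : (x : V) ∈ X' := by simp [X', hx]
    obtain ⟨a, ha, b, hb, haT, hbT, hab⟩ := exists_adj_of_connected_induce (hG _ hT) (X' : Set V)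
      (x := x) (y := y) (by
        have : (x : V) ∉ N := fun h => (Finset.mem_compl.1 (hNP h)) x.2
        simp [hxX, this]) (by simp [hy, hyN]) hxX (fun h => hy (hX'P h))
    simp only [Set.mem_ofPred_eq, Finset.mem_union, Finset.mem_sdiff, not_or, Finset.mem_coe,
      not_and, not_not] at ha hb haT hbT
    have hbP : b ∉ P := fun h => hb (hbT.1 h)
    apply hbT.2
    simp only [X', Finset.mem_map, Function.Embedding.subtype_apply] at ha
    obtain ⟨a', ha', rfl⟩ := ha
    simp only [N, Finset.mem_biUnion, mem_nbrsIn, Finset.mem_compl]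
    exact ⟨a', ha', hbP, hab⟩
  obtain ⟨g, hg, hgt⟩ := (Finset.all_card_le_biUnion_card_iff_exists_injective t).1 hall
  let Q : Finset P := Finset.univ.filter fun u => (g u).isLeft
  have hQ : k ≤ Q.card := by
    have h1 := Finset.card_filter_add_card_filter_not (s := (Finset.univ : Finset P))
      (fun u => (g u).isLeft = true)
    have h2 : ((Finset.univ : Finset P).filter fun u => ¬ (g u).isLeft = true).card ≤
        (P.card - k) := by
      refine (Finset.card_le_card_of_injOn g (t := (Finset.univ : Finset (Fin (P.card - k))).map
        (Function.Embedding.inr (α := V))) ?_ hg.injOn).trans (by simp)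
      intro u hu
      simp only [Finset.coe_filter, Finset.mem_univ, true_and, Set.mem_ofPred_eq] at hu
      cases hgu : g u with
      | inl w => simp [hgu] at hu
      | inr w => simp
    rw [Finset.card_univ, Fintype.card_coe] at h1
    change k ≤ (Finset.univ.filter fun u => (g u).isLeft = true).card
    omega
  obtain ⟨Q', hQ', hQk⟩ := Finset.exists_subset_card_eq hQ
  have hleft : ∀ u ∈ Q', ∃ w, g u = Sum.inl w := by
    intro u hu
    have := (Finset.mem_filter.1 (hQ' hu)).2
    exact Sum.isLeft_iff.1 this
  let f : V → V := fun v => if h : v ∈ P then Sum.elim id (fun _ => v) (g ⟨v, h⟩) else v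
  have hf : ∀ u : P, ∀ w, g u = Sum.inl w → f u = w := by
    intro u w h
    simp [f, h]
  refine ⟨Q'.map (Function.Embedding.subtype _), f, by rw [Finset.card_map, hQk], ?_, ?_, ?_⟩
  · intro w hw
    simp only [Finset.mem_map, Function.Embedding.subtype_apply] at hw
    obtain ⟨a, -, rfl⟩ := hw
    exact a.2
  · intro x hx y hy hxy
    simp only [Finset.mem_coe, Finset.mem_map, Function.Embedding.subtype_apply] at hx hy
    obtain ⟨a, ha, rfl⟩ := hx
    obtain ⟨b, hb, rfl⟩ := hy
    obtain ⟨w, hw⟩ := hleft a ha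
    obtain ⟨z, hz⟩ := hleft b hb
    rw [hf a w hw, hf b z hz] at hxy
    rw [hg (hw.trans (hxy ▸ hz.symm))]
  · intro x hx
    simp only [Finset.mem_map, Function.Embedding.subtype_apply] at hx
    obtain ⟨a, ha, rfl⟩ := hx
    obtain ⟨w, hw⟩ := hleft a ha
    rw [hf a w hw]
    have := hgt a
    rw [hw] at this
    simpa [t] using this

/-- Iterated choice of edge-disjoint Hamiltonian cycles along an invariant of the used edges. -/
lemma exists_hamiltonianCycle_family [DecidableEq V] {G : SimpleGraph V} {l : ℕ}
    {Inv : ℕ → Set (Sym2 V) → Prop} (h0 : Inv 0 ∅)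
    (step : ∀ i < l, ∀ E, Inv i E → ∃ (v : V) (W : G.Walk v v), W.IsHamiltonianCycle ∧
      Disjoint W.edgeSet E ∧ Inv (i + 1) (W.edgeSet ∪ E)) :
    ∀ j ≤ l, ∃ W : Fin j → Σ v, G.Walk v v, (∀ i, (W i).2.IsHamiltonianCycle) ∧
      (∀ i i', i ≠ i' → Disjoint (W i).2.edgeSet (W i').2.edgeSet) ∧
      Inv j (⋃ i, (W i).2.edgeSet) := by
  intro j
  induction j with
  | zero => exact fun _ => ⟨fun i => i.elim0, fun i => i.elim0, fun i => i.elim0, by simpa using h0⟩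
  | succ j ih =>
    intro hj
    obtain ⟨W, h1, h2, h3⟩ := ih (by omega)
    obtain ⟨v, H, hH, hd, hI⟩ := step j (by omega) _ h3
    have hd' : ∀ i, Disjoint H.edgeSet (W i).2.edgeSet := fun i =>
      hd.mono_right (Set.subset_iUnion (fun i => (W i).2.edgeSet) i)
    refine ⟨Fin.cons ⟨v, H⟩ W, ?_, ?_, ?_⟩
    · intro i
      refine Fin.cases ?_ (fun i => ?_) i
      · exact hH
      · exact h1 i
    · intro i i'
      refine Fin.cases ?_ (fun i => ?_) i <;> refine Fin.cases ?_ (fun i' => ?_) i'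
      · intro h; exact absurd rfl h
      · intro _; exact hd' i'
      · intro _; exact (hd' i).symm
      · intro h; exact h2 i i' fun h' => h (by rw [h'])
    · have : (⋃ i : Fin (j + 1), ((Fin.cons ⟨v, H⟩ W : Fin (j + 1) → Σ v, G.Walk v v) i).2.edgeSet)
          = H.edgeSet ∪ ⋃ i, (W i).2.edgeSet := by
        ext e
        simp only [Set.mem_iUnion, Set.mem_union, Fin.exists_fin_succ]
        rfl
      rw [this]
      exact hI

lemma mk_mem_setOf_sym2 {Q : V → V → Prop} {x y : V} :
    s(x, y) ∈ {e : Sym2 V | ∃ a b, e = s(a, b) ∧ Q a b} ↔ Q x y ∨ Q y x := by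
  constructor
  · rintro ⟨a, b, hab, hQ⟩
    rcases Sym2.eq_iff.1 hab with ⟨rfl, rfl⟩ | ⟨rfl, rfl⟩
    · exact Or.inl hQ
    · exact Or.inr hQ
  · rintro (h | h)
    · exact ⟨x, y, rfl, h⟩
    · exact ⟨y, x, Sym2.eq_swap, h⟩

lemma nbrsIn_fromEdgeSet_eq_empty {E : Set (Sym2 V)} {X : Finset V} {u : V}
    (h : ∀ v ∈ X, s(u, v) ∉ E) : (fromEdgeSet E).nbrsIn u X = ∅ := by
  rw [Finset.eq_empty_iff_forall_notMem]
  intro w hw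
  rw [mem_nbrsIn, fromEdgeSet_adj] at hw
  exact h w hw.1 hw.2.1

lemma card_nbrsIn_fromEdgeSet_le_one {E : Set (Sym2 V)} {X : Finset V} {u x : V}
    (h : ∀ v ∈ X, s(u, v) ∈ E → v = x) : ((fromEdgeSet E).nbrsIn u X).card ≤ 1 := by
  have : Nonempty V := ⟨u⟩
  rw [Finset.card_le_one_iff_subset_singleton]
  · refine ⟨x, fun w hw => ?_⟩
    rw [mem_nbrsIn, fromEdgeSet_adj] at hw
    exact Finset.mem_singleton.2 (h w hw.1 hw.2.1)

/-! ### One Hamiltonian cycle with prescribed crossings; crossing through two rich vertices -/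

namespace IsSplit

variable [Fintype V] {G : SimpleGraph V} {k l d : ℕ} {A B S : Finset V}

lemma card_nbrsIn_union [DecidableEq V] (h : G.IsSplit k l d A B S) (v : V) :
    (G.nbrsIn v (A ∪ B)).card = (G.nbrsIn v A).card + (G.nbrsIn v B).card := by
  rw [nbrsIn_union, Finset.card_union_of_disjoint]
  rw [Finset.disjoint_left]
  intro w hw hw'
  exact Finset.disjoint_left.1 h.disjAB (mem_nbrsIn.1 hw).1 (mem_nbrsIn.1 hw').1

/-- A split graph has a Hamiltonian cycle using two given crossings and avoiding a reserved matching
`R`, the edges `E` of few earlier cycles, and a set `F` containing all other crossing edges. -/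
lemma exists_hamiltonianCycle [DecidableEq V] (h : G.IsSplit k l d A B S)
    {R E F : Set (Sym2 V)} {i : ℕ} (hi : i < l)
    (hE : ∀ v X, ((fromEdgeSet E).nbrsIn v X).card ≤ 2 * i)
    (hR : ∀ v X, ((fromEdgeSet R).nbrsIn v X).card ≤ 1)
    (hRA : ∀ u ∈ A, ∀ v ∈ A, s(u, v) ∉ R) (hRB : ∀ u ∈ B, ∀ v ∈ B, s(u, v) ∉ R)
    (hFA : ∀ u ∈ A, ∀ v ∈ A, s(u, v) ∉ F) (hFB : ∀ u ∈ B, ∀ v ∈ B, s(u, v) ∉ F)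
    {p p' q q' : V} (hp : p ∈ A) (hp' : p' ∈ A) (hq : q ∈ B) (hq' : q' ∈ B)
    (hpp : p ≠ p') (hqq : q ≠ q') {C C' : List V} (hC : ∀ v ∈ C, v ∈ S) (hC' : ∀ v ∈ C', v ∈ S)
    (hnd : (C ++ C').Nodup) (hch : (q :: C ++ [p]).IsChain (G.deleteEdges (R ∪ (E ∪ F))).Adj)
    (hch' : (p' :: C' ++ [q']).IsChain (G.deleteEdges (R ∪ (E ∪ F))).Adj)
    (hcross : ∀ a ∈ A, ∀ b ∈ B, G.Adj a b → s(a, b) ∉ F → (a = p ∨ a = p') ∧ (b = q ∨ b = q'))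
    (hFS : ∀ s ∈ S, s ∉ C → s ∉ C' → ((fromEdgeSet F).nbrsIn s (A ∪ B)).card ≤ l + 1) :
    ∃ (v : V) (W : G.Walk v v), W.IsHamiltonianCycle ∧
      ∀ e ∈ W.edgeSet, e ∉ R ∧ e ∉ E ∧ e ∉ F := by
  have hle_d := h.le_d
  have hcS := h.cardS
  have hl := h.two_le_l
  have hsum := h.card_add
  have hdel : ∀ v X, (G.nbrsIn v X).card ≤ ((G.deleteEdges (R ∪ (E ∪ F))).nbrsIn v X).card +
      (((fromEdgeSet R).nbrsIn v X).card + (2 * i + ((fromEdgeSet F).nbrsIn v X).card)) := by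
    intro v X
    have h1 := card_nbrsIn_le_deleteEdges G (R ∪ (E ∪ F)) v X
    have h2 := card_nbrsIn_fromEdgeSet_union_le R (E ∪ F) v X
    have h3 := card_nbrsIn_fromEdgeSet_union_le E F v X
    have h4 := hE v X
    omega
  -- `R` and `F` have no edges inside a part, so only the earlier cycles cost degree there: 2(d -
  -- |S| - 2 - 2i) ≥ (d + 1) + |S| + 2.
  have hside : ∀ {A B : Finset V}, G.IsSplit k l d A B S →
      (∀ u ∈ A, ∀ v ∈ A, s(u, v) ∉ R) → (∀ u ∈ A, ∀ v ∈ A, s(u, v) ∉ F) →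
      ∀ u ∈ A, A.card + S.card + 2 ≤
        2 * ((G.deleteEdges (R ∪ (E ∪ F))).nbrsIn u A).card := by
    intro A B h hRA hFA u hu
    have h1 := hdel u A
    rw [nbrsIn_fromEdgeSet_eq_empty (hRA u hu), nbrsIn_fromEdgeSet_eq_empty (hFA u hu),
      Finset.card_empty] at h1
    have h2 := h.le_card_nbrsIn_of_mem hu
    have h3 := h.card_left_le
    omega
  have hV : 3 ≤ Fintype.card V := by
    have := h.le_card_left
    omega
  obtain ⟨L, hL⟩ := exists_isHamList_of_crossing (G := G.deleteEdges (R ∪ (E ∪ F))) hV h.disjAB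
    h.disjSA h.disjSB h.cover hp hp' hq hq' hpp hqq hC hC' hnd hch hch' (by
      intro a ha b hb hab
      rw [deleteEdges_adj] at hab
      exact hcross a ha b hb hab.1 fun h' => hab.2 (Or.inr (Or.inr h')))
    (hside h hRA hFA) (hside h.symm hRB hFB) (by
      intro s hs hsC hsC'
      have h1 := hdel s (A ∪ B)
      have h2 := h.le_card_nbrsIn_of_mem_S hs
      have h3 := hR s (A ∪ B)
      have h4 := hFS s hs hsC hsC'
      rw [h.card_nbrsIn_union] at h1
      omega)
  obtain ⟨v, W, hW⟩ := hL.exists_walk hV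
  refine ⟨v, W.mapLe (deleteEdges_le _), hW.map Function.bijective_id, ?_⟩
  intro e he
  rw [Walk.mem_edgeSet, Walk.edges_mapLe_eq_edges] at he
  have := W.edges_subset_edgeSet he
  rw [edgeSet_deleteEdges] at this
  have := this.2
  simp only [Set.mem_union, not_or] at this
  tauto

/-- Edge-disjoint Hamiltonian cycles that all cross through the same two vertices. -/
lemma exists_family_of_two_rich [DecidableEq V] (h : G.IsSplit k l d A B S) {R : Set (Sym2 V)}
    (hR : ∀ v X, ((fromEdgeSet R).nbrsIn v X).card ≤ 1)
    (hRA : ∀ u ∈ A, ∀ v ∈ A, s(u, v) ∉ R) (hRB : ∀ u ∈ B, ∀ v ∈ B, s(u, v) ∉ R)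
    {s t : V} (hs : s ∈ S) (ht : t ∈ S) (hst : s ≠ t)
    (hsA : l + 2 ≤ (G.nbrsIn s A).card) (hsB : l + 2 ≤ (G.nbrsIn s B).card)
    (htA : l + 2 ≤ (G.nbrsIn t A).card) (htB : l + 2 ≤ (G.nbrsIn t B).card) :
    ∃ W : Fin l → Σ v, G.Walk v v, (∀ i, (W i).2.IsHamiltonianCycle) ∧
      (∀ i i', i ≠ i' → Disjoint (W i).2.edgeSet (W i').2.edgeSet) ∧
      (∀ i, Disjoint (W i).2.edgeSet R) ∧
      ∀ v X, ((fromEdgeSet (⋃ i, (W i).2.edgeSet)).nbrsIn v X).card ≤ 2 * l := by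
  have xSA : ∀ v, v ∈ S → v ∉ A := fun v hv => Finset.disjoint_left.1 h.disjSA hv
  have xSB : ∀ v, v ∈ S → v ∉ B := fun v hv => Finset.disjoint_left.1 h.disjSB hv
  have xAB : ∀ v, v ∈ A → v ∉ B := fun v hv => Finset.disjoint_left.1 h.disjAB hv
  -- The last clause counts one edge per cycle, not two, from `s` and from `t` to each part. The set
  -- `F` below enforces this.
  let Inv : ℕ → Set (Sym2 V) → Prop := fun i E =>
    (∀ v X, ((fromEdgeSet E).nbrsIn v X).card ≤ 2 * i) ∧ Disjoint E R ∧
    ∀ r, r = s ∨ r = t → ((fromEdgeSet E).nbrsIn r A).card ≤ i ∧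
      ((fromEdgeSet E).nbrsIn r B).card ≤ i
  suffices hstep : ∀ i < l, ∀ E, Inv i E → ∃ (v : V) (W : G.Walk v v), W.IsHamiltonianCycle ∧
      Disjoint W.edgeSet E ∧ Inv (i + 1) (W.edgeSet ∪ E) by
    obtain ⟨W, h1, h2, h3, h4, -⟩ := exists_hamiltonianCycle_family (Inv := Inv)
      ⟨by simp [nbrsIn], by simp, by simp [nbrsIn]⟩ hstep l le_rfl
    exact ⟨W, h1, h2, fun i =>
      h4.mono_left (Set.subset_iUnion (fun i => (W i).2.edgeSet) i), h3⟩
  rintro i hi E ⟨hE, hER, hst'⟩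
  have hsE := hst' s (Or.inl rfl)
  have htE := hst' t (Or.inr rfl)
  -- Of l + 2 neighbours, at most l - 1 are used and one is reserved. Two remain, so a given `z` can
  -- be avoided.
  have avail : ∀ r X, ((fromEdgeSet E).nbrsIn r X).card ≤ i → l + 2 ≤ (G.nbrsIn r X).card →
      ∀ z, ∃ x ∈ (G.deleteEdges (R ∪ E)).nbrsIn r X, x ≠ z := by
    intro r X hr hX z
    have e1 := card_nbrsIn_le_deleteEdges G (R ∪ E) r X
    have e2 := card_nbrsIn_fromEdgeSet_union_le R E r X
    have e3 := hR r X
    exact Finset.exists_mem_ne (by omega) z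
  obtain ⟨p, hp, -⟩ := avail s A hsE.1 hsA s
  obtain ⟨q, hq, -⟩ := avail s B hsE.2 hsB s
  obtain ⟨p', hp', hpp⟩ := avail t A htE.1 htA p
  obtain ⟨q', hq', hqq⟩ := avail t B htE.2 htB q
  rw [mem_nbrsIn, deleteEdges_adj, Set.mem_union, not_or] at hp hq hp' hq'
  let Q : V → V → Prop := fun x y => (x ∈ A ∧ y ∈ B) ∨
    (x = s ∧ (y ∈ A ∨ y ∈ B) ∧ y ≠ p ∧ y ≠ q) ∨ (x = t ∧ (y ∈ A ∨ y ∈ B) ∧ y ≠ p' ∧ y ≠ q')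
  let F : Set (Sym2 V) := {e | ∃ a b, e = s(a, b) ∧ Q a b}
  have hF : ∀ x y, s(x, y) ∈ F ↔ Q x y ∨ Q y x := fun x y => mk_mem_setOf_sym2
  have hsA' := xSA s hs
  have hsB' := xSB s hs
  have htA' := xSA t ht
  have htB' := xSB t ht
  have inA : ∀ u ∈ A, ∀ v ∈ A, s(u, v) ∉ F := by
    intro u hu v hv
    have h1 : u ≠ s ∧ v ≠ s ∧ u ≠ t ∧ v ≠ t :=
      ⟨fun h => hsA' (h ▸ hu), fun h => hsA' (h ▸ hv), fun h => htA' (h ▸ hu),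
        fun h => htA' (h ▸ hv)⟩
    have h2 := xAB u hu
    have h3 := xAB v hv
    rw [hF]
    simp only [Q]
    tauto
  have inB : ∀ u ∈ B, ∀ v ∈ B, s(u, v) ∉ F := by
    intro u hu v hv
    have h1 : u ≠ s ∧ v ≠ s ∧ u ≠ t ∧ v ≠ t :=
      ⟨fun h => hsB' (h ▸ hu), fun h => hsB' (h ▸ hv), fun h => htB' (h ▸ hu),
        fun h => htB' (h ▸ hv)⟩
    have h2 := fun h => xAB u h hu
    have h3 := fun h => xAB v h hv
    rw [hF]
    simp only [Q]
    tauto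
  have hpS : p ≠ s ∧ p ≠ t := ⟨fun h => hsA' (h ▸ hp.1), fun h => htA' (h ▸ hp.1)⟩
  have hqS : q ≠ s ∧ q ≠ t := ⟨fun h => hsB' (h ▸ hq.1), fun h => htB' (h ▸ hq.1)⟩
  have hpS' : p' ≠ s ∧ p' ≠ t := ⟨fun h => hsA' (h ▸ hp'.1), fun h => htA' (h ▸ hp'.1)⟩
  have hqS' : q' ≠ s ∧ q' ≠ t := ⟨fun h => hsB' (h ▸ hq'.1), fun h => htB' (h ▸ hq'.1)⟩
  have hF1 : s(s, p) ∉ F := by rw [hF]; simp only [Q]; tauto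
  have hF2 : s(s, q) ∉ F := by rw [hF]; simp only [Q]; tauto
  have hF3 : s(t, p') ∉ F := by
    have := hst.symm
    rw [hF]; simp only [Q]; tauto
  have hF4 : s(t, q') ∉ F := by
    have := hst.symm
    rw [hF]; simp only [Q]; tauto
  have hadj : ∀ {r x}, G.Adj r x ∧ s(r, x) ∉ R ∧ s(r, x) ∉ E → s(r, x) ∉ F →
      (G.deleteEdges (R ∪ (E ∪ F))).Adj r x := by
    intro r x h1 h2
    simp only [deleteEdges_adj, Set.mem_union]
    tauto
  obtain ⟨v, W, hW, hWe⟩ := h.exists_hamiltonianCycle (F := F) hi hE hR hRA hRB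
    inA inB hp.1 hp'.1 hq.1 hq'.1 hpp.symm hqq.symm
    (C := [s]) (C' := [t]) (by simpa using hs) (by simpa using ht) (by simpa using hst)
    (.cons_cons (hadj hq.2 hF2).symm (.cons_cons (hadj hp.2 hF1) (.singleton _)))
    (.cons_cons (hadj hp'.2 hF3).symm (.cons_cons (hadj hq'.2 hF4) (.singleton _)))
    (by
      intro a ha b hb _ hab
      refine absurd ?_ hab
      rw [hF]
      exact Or.inl (Or.inl ⟨ha, hb⟩))
    (by
      intro r hr hrs hrt
      rw [List.mem_singleton] at hrs hrt
      rw [nbrsIn_fromEdgeSet_eq_empty]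
      · simp
      · intro v hv
        have h3 : ∀ w ∈ S, v ≠ w := by
          rintro w hw rfl
          rcases Finset.mem_union.1 hv with hv | hv
          · exact xSA v hw hv
          · exact xSB v hw hv
        rw [hF]
        rintro ((⟨h', -⟩ | ⟨h', -⟩ | ⟨h', -⟩) | (⟨-, h'⟩ | ⟨h', -⟩ | ⟨h', -⟩))
        · exact xSA r hr h'
        · exact hrs h'
        · exact hrt h'
        · exact xSB r hr h'
        · exact h3 s hs h'
        · exact h3 t ht h')
  have hWF : ∀ x y, s(x, y) ∈ W.edgeSet → ¬ Q x y := fun x y hxy hQ =>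
    (hWe _ hxy).2.2 ((hF x y).2 (Or.inl hQ))
  refine ⟨v, W, hW, Set.disjoint_left.2 fun e he => (hWe e he).2.1, ?_, ?_, ?_⟩
  · intro v X
    have h1 := card_nbrsIn_fromEdgeSet_union_le W.edgeSet E v X
    have h2 := hW.card_nbrsIn_le_two v X
    have h3 := hE v X
    omega
  · exact Set.disjoint_union_left.2 ⟨Set.disjoint_left.2 fun e he => (hWe e he).1, hER⟩
  · have hone : ∀ r X x, (∀ v ∈ X, s(r, v) ∈ W.edgeSet → v = x) →
        ((fromEdgeSet E).nbrsIn r X).card ≤ i →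
        ((fromEdgeSet (W.edgeSet ∪ E)).nbrsIn r X).card ≤ i + 1 := by
      intro r X x hx hr
      have h1 := card_nbrsIn_fromEdgeSet_union_le W.edgeSet E r X
      have h2 := card_nbrsIn_fromEdgeSet_le_one hx
      omega
    rintro r (rfl | rfl)
    · refine ⟨hone r A p (fun v hv hvW => ?_) hsE.1, hone r B q (fun v hv hvW => ?_) hsE.2⟩
      · by_contra hne
        exact hWF r v hvW (Or.inr (Or.inl ⟨rfl, Or.inl hv, hne, fun h => xAB v hv (h ▸ hq.1)⟩))
      · by_contra hne
        exact hWF r v hvW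
          (Or.inr (Or.inl ⟨rfl, Or.inr hv, fun h => xAB p hp.1 (h ▸ hv), hne⟩))
    · refine ⟨hone r A p' (fun v hv hvW => ?_) htE.1, hone r B q' (fun v hv hvW => ?_) htE.2⟩
      · by_contra hne
        exact hWF r v hvW
          (Or.inr (Or.inr ⟨rfl, Or.inl hv, hne, fun h => xAB v hv (h ▸ hq'.1)⟩))
      · by_contra hne
        exact hWF r v hvW
          (Or.inr (Or.inr ⟨rfl, Or.inr hv, fun h => xAB p' hp'.1 (h ▸ hv), hne⟩))

end IsSplit

/-! ### Crossing along one chosen edge per vertex of the smaller side -/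

namespace IsSplit

variable [Fintype V] {G : SimpleGraph V} {k l d : ℕ} {A B S : Finset V}

/-- Edge-disjoint Hamiltonian cycles crossing along edges that are chosen one for each
vertex of `A`. -/
lemma exists_family_of_stars [DecidableEq V] (h : G.IsSplit k l d A B S) {R : Set (Sym2 V)}
    (hR : ∀ v X, ((fromEdgeSet R).nbrsIn v X).card ≤ 1)
    (hRA : ∀ u ∈ A, ∀ v ∈ A, s(u, v) ∉ R) (hRB : ∀ u ∈ B, ∀ v ∈ B, s(u, v) ∉ R)
    {U : Finset V} (hU : U ⊆ S) (hUA : ∀ s ∈ U, (G.nbrsIn s A).card ≤ l + 1)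
    {f : V → V} (hf : ∀ a ∈ A, (f a ∈ B ∨ f a ∈ U) ∧ G.Adj a (f a))
    (hRf : ∀ X ⊆ A, (∀ a ∈ X, s(a, f a) ∈ R) → X.card ≤ k) :
    ∃ W : Fin l → Σ v, G.Walk v v, (∀ i, (W i).2.IsHamiltonianCycle) ∧
      (∀ i i', i ≠ i' → Disjoint (W i).2.edgeSet (W i').2.edgeSet) ∧
      (∀ i, Disjoint (W i).2.edgeSet R) ∧
      ∀ v X, ((fromEdgeSet (⋃ i, (W i).2.edgeSet)).nbrsIn v X).card ≤ 2 * l := by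
  classical
  have xSA : ∀ v, v ∈ S → v ∉ A := fun v hv => Finset.disjoint_left.1 h.disjSA hv
  have xSB : ∀ v, v ∈ S → v ∉ B := fun v hv => Finset.disjoint_left.1 h.disjSB hv
  have xAB : ∀ v, v ∈ A → v ∉ B := fun v hv => Finset.disjoint_left.1 h.disjAB hv
  have hle_d := h.le_d
  have hcS := h.cardS
  have hl := h.two_le_l
  -- The last clause: each cycle uses at most two of the chosen edges `s(a, f a)`.
  let Inv : ℕ → Set (Sym2 V) → Prop := fun i E =>
    (∀ v X, ((fromEdgeSet E).nbrsIn v X).card ≤ 2 * i) ∧ Disjoint E R ∧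
    ∀ X ⊆ A, (∀ a ∈ X, s(a, f a) ∈ E) → X.card ≤ 2 * i
  suffices hstep : ∀ i < l, ∀ E, Inv i E → ∃ (v : V) (W : G.Walk v v), W.IsHamiltonianCycle ∧
      Disjoint W.edgeSet E ∧ Inv (i + 1) (W.edgeSet ∪ E) by
    obtain ⟨W, h1, h2, h3, h4, -⟩ := exists_hamiltonianCycle_family (Inv := Inv)
      ⟨by simp [nbrsIn], by simp, fun X _ hX => by
        simp [Finset.eq_empty_of_forall_notMem fun a ha => hX a ha]⟩ hstep l le_rfl
    exact ⟨W, h1, h2, fun i =>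
      h4.mono_left (Set.subset_iUnion (fun i => (W i).2.edgeSet) i), h3⟩
  rintro i hi E ⟨hE, hER, hEf⟩
  have hfA : ∀ a ∈ A, f a ∉ A := by
    intro a ha hfa
    rcases (hf a ha).1 with h1 | h1
    · exact xAB _ hfa h1
    · exact xSA _ (hU h1) hfa
  -- At most k chosen edges are reserved and 2i used, and |A| ≥ 2k + 4l + 1, so more than l + 1
  -- remain. They cannot all end at one vertex, which has at most l + 1 neighbours in `A`.
  obtain ⟨x, hx, y, hy, hxy⟩ : ∃ x ∈ A.filter fun a => s(a, f a) ∉ R ∧ s(a, f a) ∉ E,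
      ∃ y ∈ A.filter fun a => s(a, f a) ∉ R ∧ s(a, f a) ∉ E, f x ≠ f y := by
    by_contra hcon
    push Not at hcon
    set X := A.filter fun a => s(a, f a) ∉ R ∧ s(a, f a) ∉ E with hX
    have h1 : A ⊆ X ∪ ((A.filter fun a => s(a, f a) ∈ R) ∪ A.filter fun a => s(a, f a) ∈ E) := by
      intro a ha
      simp only [hX, Finset.mem_union, Finset.mem_filter]
      tauto
    have h2 := (Finset.card_le_card h1).trans (Finset.card_union_le _ _)
    have h3 := Finset.card_union_le (A.filter fun a => s(a, f a) ∈ R)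
      (A.filter fun a => s(a, f a) ∈ E)
    have h4 := h.le_card_left
    have h8 := hRf _ (Finset.filter_subset _ _) fun a ha => (Finset.mem_filter.1 ha).2
    have h9 := hEf _ (Finset.filter_subset _ _) fun a ha => (Finset.mem_filter.1 ha).2
    obtain ⟨x, hx⟩ : X.Nonempty := by
      rw [← Finset.card_pos]
      omega
    have hxA := (Finset.mem_filter.1 hx).1
    have h5 : X ⊆ G.nbrsIn (f x) A := by
      intro y hy
      have hyA := (Finset.mem_filter.1 hy).1
      rw [mem_nbrsIn, hcon x hx y hy]
      exact ⟨hyA, (hf y hyA).2.symm⟩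
    have h6 := Finset.card_le_card h5
    have h7 : (G.nbrsIn (f x) A).card ≤ l + 1 := by
      rcases (hf x hxA).1 with h7 | h7
      · exact (h.crossB _ h7).trans (by omega)
      · exact hUA _ h7
    omega
  rw [Finset.mem_filter] at hx hy
  obtain ⟨hxA, hxR, hxE⟩ := hx
  obtain ⟨hyA, hyR, hyE⟩ := hy
  have hne : x ≠ y := fun h => hxy (h ▸ rfl)
  -- All edges from `A` to `B ∪ U` are forbidden except the two selected ones, so no other chosen
  -- edge is spent. A vertex of `U` off the crossing paths loses at most l + 1 edges.
  let Q : V → V → Prop := fun a b => a ∈ A ∧ (b ∈ B ∨ b ∈ U) ∧ G.Adj a b ∧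
    ¬ (a = x ∧ b = f x) ∧ ¬ (a = y ∧ b = f y)
  let F : Set (Sym2 V) := {e | ∃ a b, e = s(a, b) ∧ Q a b}
  have hF : ∀ a b, s(a, b) ∈ F ↔ Q a b ∨ Q b a := fun a b => mk_mem_setOf_sym2
  have inA : ∀ u ∈ A, ∀ v ∈ A, s(u, v) ∉ F := by
    have : ∀ u ∈ A, ∀ v, ¬ Q v u := by
      rintro u hu v ⟨-, h1 | h1, -⟩
      · exact xAB u hu h1
      · exact xSA u (hU h1) hu
    intro u hu v hv
    rw [hF]
    rintro (h1 | h1)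
    · exact this v hv u h1
    · exact this u hu v h1
  have notA : ∀ u, u ∉ A → ∀ v, v ∉ A → s(u, v) ∉ F := by
    intro u hu v hv
    rw [hF]
    rintro (h1 | h1)
    · exact hu h1.1
    · exact hv h1.1
  have xBA : ∀ v, v ∈ B → v ∉ A := fun v hv hv' => xAB v hv' hv
  have hstarF : ∀ a, (a = x ∨ a = y) → s(a, f a) ∉ F := by
    intro a ha
    rw [hF]
    rintro (⟨-, -, -, h1, h2⟩ | ⟨h1, -⟩)
    · rcases ha with rfl | rfl
      · exact h1 ⟨rfl, rfl⟩
      · exact h2 ⟨rfl, rfl⟩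
    · rcases ha with rfl | rfl
      · exact hfA _ hxA h1
      · exact hfA _ hyA h1
  let K := G.deleteEdges (R ∪ (E ∪ F))
  have hK : ∀ {u v}, K.Adj u v ↔ G.Adj u v ∧ s(u, v) ∉ R ∧ s(u, v) ∉ E ∧ s(u, v) ∉ F := by
    intro u v
    simp only [K, deleteEdges_adj, Set.mem_union, not_or]
  have hKx : K.Adj x (f x) := hK.2 ⟨(hf x hxA).2, hxR, hxE, hstarF x (Or.inl rfl)⟩
  have hKy : K.Adj y (f y) := hK.2 ⟨(hf y hyA).2, hyR, hyE, hstarF y (Or.inr rfl)⟩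
  -- When `f a` lies in `U`, the path continues to `B`, where `f a` has many neighbours. The vertex
  -- `z` is avoided to keep the two ends in `B` distinct.
  have link : ∀ a z, a ∈ A → K.Adj a (f a) → ∃ q ∈ B, ∃ C : List V,
      (q = f a ∧ C = [] ∨ q ≠ z ∧ C = [f a] ∧ f a ∈ S) ∧ (q :: C ++ [a]).IsChain K.Adj ∧
      (a :: C ++ [q]).IsChain K.Adj := by
    intro a z ha hKa
    rcases (hf a ha).1 with hb | hu
    · exact ⟨f a, hb, [], Or.inl ⟨rfl, rfl⟩, .cons_cons hKa.symm (.singleton _),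
        .cons_cons hKa (.singleton _)⟩
    · have hs := hU hu
      have e1 := h.le_card_nbrsIn_of_mem_S hs
      have e2 := hUA _ hu
      have e3 := card_nbrsIn_le_deleteEdges G (R ∪ E) (f a) B
      have e4 := card_nbrsIn_fromEdgeSet_union_le R E (f a) B
      have e5 := hR (f a) B
      have e6 := hE (f a) B
      obtain ⟨q, hq, hqz⟩ := Finset.exists_mem_ne
        (s := (G.deleteEdges (R ∪ E)).nbrsIn (f a) B) (by omega) z
      rw [mem_nbrsIn, deleteEdges_adj, Set.mem_union, not_or] at hq
      have hKq : K.Adj (f a) q :=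
        hK.2 ⟨hq.2.1, hq.2.2.1, hq.2.2.2, notA _ (xSA _ hs) _ (xBA _ hq.1)⟩
      exact ⟨q, hq.1, [f a], Or.inr ⟨hqz, rfl, hs⟩,
        .cons_cons hKq.symm (.cons_cons hKa.symm (.singleton _)),
        .cons_cons hKa (.cons_cons hKq (.singleton _))⟩
  obtain ⟨q, hq, C, hC, hch, -⟩ := link x (f y) hxA hKx
  obtain ⟨q', hq', C', hC', -, hch'⟩ := link y q hyA hKy
  have hqq : q ≠ q' := by
    rcases hC with ⟨rfl, -⟩ | ⟨h1, -⟩ <;> rcases hC' with ⟨rfl, -⟩ | ⟨h2, -⟩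
    · exact hxy
    · exact h2.symm
    · exact h1
    · exact h2.symm
  have hnd : (C ++ C').Nodup := by
    rcases hC with ⟨-, rfl⟩ | ⟨-, rfl, -⟩ <;> rcases hC' with ⟨-, rfl⟩ | ⟨-, rfl, -⟩ <;>
      simp [hxy]
  obtain ⟨v, W, hW, hWe⟩ := h.exists_hamiltonianCycle (F := F) hi hE hR hRA hRB
    inA (fun u hu v hv => notA u (xBA u hu) v (xBA v hv)) hxA hyA hq hq' hne hqq
    (C := C) (C' := C')
    (by rcases hC with ⟨-, rfl⟩ | ⟨-, rfl, h1⟩ <;> simp [*])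
    (by rcases hC' with ⟨-, rfl⟩ | ⟨-, rfl, h1⟩ <;> simp [*])
    hnd hch hch'
    (by
      intro a ha b hb hab hnF
      have h1 : (a = x ∧ b = f x) ∨ (a = y ∧ b = f y) := by
        by_contra hcon
        rw [not_or] at hcon
        exact hnF ((hF a b).2 (Or.inl ⟨ha, Or.inl hb, hab, hcon.1, hcon.2⟩))
      rcases h1 with ⟨rfl, rfl⟩ | ⟨rfl, rfl⟩
      · refine ⟨Or.inl rfl, Or.inl ?_⟩
        rcases hC with ⟨h1, -⟩ | ⟨-, -, h1⟩
        · exact h1.symm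
        · exact absurd hb (xSB _ h1)
      · refine ⟨Or.inr rfl, Or.inr ?_⟩
        rcases hC' with ⟨h1, -⟩ | ⟨-, -, h1⟩
        · exact h1.symm
        · exact absurd hb (xSB _ h1))
    (by
      intro r hr _ _
      have hsub : (fromEdgeSet F).nbrsIn r (A ∪ B) ⊆ if r ∈ U then G.nbrsIn r A else ∅ := by
        intro w hw
        rw [mem_nbrsIn, fromEdgeSet_adj, hF] at hw
        obtain ⟨hw, h1 | h1, -⟩ := hw
        · exact absurd h1.1 (xSA r hr)
        · obtain ⟨h2, h3 | h3, h4, -⟩ := h1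
          · exact absurd h3 (xSB r hr)
          · rw [if_pos h3, mem_nbrsIn]
            exact ⟨h2, h4.symm⟩
      refine (Finset.card_le_card hsub).trans ?_
      split_ifs with h1
      · exact hUA r h1
      · simp)
  refine ⟨v, W, hW, Set.disjoint_left.2 fun e he => (hWe e he).2.1, ?_, ?_, ?_⟩
  · intro v X
    have h1 := card_nbrsIn_fromEdgeSet_union_le W.edgeSet E v X
    have h2 := hW.card_nbrsIn_le_two v X
    have h3 := hE v X
    omega
  · exact Set.disjoint_union_left.2 ⟨Set.disjoint_left.2 fun e he => (hWe e he).1, hER⟩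
  · intro X hXA hX
    have hsub : X ⊆ {x, y} ∪ X.filter fun a => s(a, f a) ∈ E := by
      intro a ha
      simp only [Finset.mem_union, Finset.mem_insert, Finset.mem_singleton, Finset.mem_filter]
      rcases hX a ha with h1 | h1
      · left
        by_contra hcon
        rw [not_or] at hcon
        have h2 := hf a (hXA ha)
        refine (hWe _ h1).2.2 ((hF _ _).2 (Or.inl ⟨hXA ha, h2.1, h2.2, ?_, ?_⟩))
        · exact fun h' => hcon.1 h'.1
        · exact fun h' => hcon.2 h'.1
      · exact Or.inr ⟨ha, h1⟩
    have h1 := (Finset.card_le_card hsub).trans (Finset.card_union_le _ _)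
    have h2 : ({x, y} : Finset V).card ≤ 2 := Finset.card_le_two
    have h3 := hEf (X.filter fun a => s(a, f a) ∈ E) ((Finset.filter_subset _ _).trans hXA)
      fun a ha => (Finset.mem_filter.1 ha).2
    omega

/-- If the side of `A` is not larger than that of `B`, up to one exceptional vertex, then each vertex
of `A` has a neighbour on the side of `B`. -/
lemma exists_star_map [DecidableEq V] (h : G.IsSplit k l d A B S) {U U' D : Finset V}
    (hS : ∀ s ∈ S, s ∈ U ∨ s ∈ U' ∨ s ∈ D) (hD : D.card ≤ 1)
    (hcard : 2 * (A.card + U'.card) + D.card ≤ Fintype.card V) :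
    ∃ f : V → V, ∀ a ∈ A, (f a ∈ B ∨ f a ∈ U) ∧ G.Adj a (f a) := by
  have key : ∀ a, ∃ b, a ∈ A → (b ∈ B ∨ b ∈ U) ∧ G.Adj a b := by
    intro a
    by_cases ha : a ∈ A
    · by_contra hcon
      push Not at hcon
      -- Otherwise `a` has at most |A| - 1 + |U'| + |D| neighbours; twice this is at most n + |D| -
      -- 2 < n, against the degree bound.
      have hsub : G.nbrsIn a Finset.univ ⊆ (A.erase a ∪ U') ∪ D := by
        intro w hw
        rw [mem_nbrsIn] at hw
        have h1 := (hcon w).2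
        have h2 := h.cover w
        have h3 := hS w
        simp only [Finset.mem_union, Finset.mem_erase]
        have := hw.2.ne'
        tauto
      have h1 := (Finset.card_le_card hsub).trans (Finset.card_union_le _ _)
      have h2 := Finset.card_union_le (A.erase a) U'
      rw [Finset.card_erase_of_mem ha] at h2
      have h3 := h.degree a
      have h4 := h.card_le
      have : 0 < A.card := Finset.card_pos.2 ⟨a, ha⟩
      omega
    · exact ⟨a, fun h => absurd h ha⟩
  choose f hf using key
  exact ⟨f, hf⟩

/-- A `k`-connected split graph has `l` edge-disjoint Hamiltonian cycles whose removal
leaves a `k`-connected graph. -/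
lemma exists_family [DecidableEq V] (h : G.IsSplit k l d A B S) (hG : G.IsKConnected k) :
    ∃ W : Fin l → Σ v, G.Walk v v, (∀ i, (W i).2.IsHamiltonianCycle) ∧
      (∀ i i', i ≠ i' → Disjoint (W i).2.edgeSet (W i').2.edgeSet) ∧
      (G.deleteEdges (⋃ i, (W i).2.edgeSet)).IsKConnected k := by
  classical
  have xSA : ∀ v, v ∈ S → v ∉ A := fun v hv => Finset.disjoint_left.1 h.disjSA hv
  have xSB : ∀ v, v ∈ S → v ∉ B := fun v hv => Finset.disjoint_left.1 h.disjSB hv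
  have xAB : ∀ v, v ∈ A → v ∉ B := fun v hv => Finset.disjoint_left.1 h.disjAB hv
  have hle_d := h.le_d
  have hcS := h.cardS
  have hl := h.two_le_l
  have hsum := h.card_add
  have hA := h.le_card_left
  have hB := h.symm.le_card_left
  -- Each vertex of `S` joins the side where it has more neighbours, ties going to `A`.
  set P := A ∪ S.filter fun s => (G.nbrsIn s B).card ≤ (G.nbrsIn s A).card with hP
  have hAP : A ⊆ P := Finset.subset_union_left
  have hBP : ∀ b ∈ B, b ∉ P := by
    intro b hb hbP
    rw [hP, Finset.mem_union, Finset.mem_filter] at hbP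
    rcases hbP with h1 | h1
    · exact xAB b h1 hb
    · exact xSB b h1.1 hb
  obtain ⟨M, f, hMk, hMP, hinj, hM⟩ := hG.exists_matching P
    ((by omega : k ≤ A.card).trans (Finset.card_le_card hAP))
    ((by omega : k ≤ B.card).trans (Finset.card_le_card fun b hb =>
      Finset.mem_compl.2 (hBP b hb))) (by omega)
  set R : Set (Sym2 V) := (fun u => s(u, f u)) '' (M : Set V) with hRdef
  have memR : ∀ x y, s(x, y) ∈ R → (x ∈ M ∧ y = f x) ∨ (y ∈ M ∧ x = f y) := by
    rintro x y ⟨u, hu, hxy⟩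
    rcases Sym2.eq_iff.1 hxy with ⟨rfl, rfl⟩ | ⟨rfl, rfl⟩
    · exact Or.inl ⟨hu, rfl⟩
    · exact Or.inr ⟨hu, rfl⟩
  have hR : ∀ v X, ((fromEdgeSet R).nbrsIn v X).card ≤ 1 := by
    intro v X
    by_cases hv : v ∈ P
    · refine card_nbrsIn_fromEdgeSet_le_one (x := f v) fun w _ hw => ?_
      rcases memR _ _ hw with h1 | h1
      · exact h1.2
      · exact absurd (h1.2 ▸ hv) (hM w h1.1).1
    · by_cases hv' : ∃ u ∈ M, v = f u
      · obtain ⟨u, hu, rfl⟩ := hv'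
        refine card_nbrsIn_fromEdgeSet_le_one (x := u) fun w _ hw => ?_
        rcases memR _ _ hw with h1 | h1
        · exact absurd (hMP h1.1) hv
        · exact (hinj hu h1.1 h1.2).symm
      · refine card_nbrsIn_fromEdgeSet_le_one (x := v) fun w _ hw => ?_
        rcases memR _ _ hw with h1 | h1
        · exact absurd (hMP h1.1) hv
        · exact absurd ⟨w, h1⟩ hv'
  have hRA : ∀ u ∈ A, ∀ v ∈ A, s(u, v) ∉ R := by
    intro u hu v hv huv
    rcases memR _ _ huv with h1 | h1
    · exact (hM u h1.1).1 (h1.2 ▸ hAP hv)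
    · exact (hM v h1.1).1 (h1.2 ▸ hAP hu)
  have hRB : ∀ u ∈ B, ∀ v ∈ B, s(u, v) ∉ R := by
    intro u hu v hv huv
    rcases memR _ _ huv with h1 | h1
    · exact hBP u hu (hMP h1.1)
    · exact hBP v hv (hMP h1.1)
  -- Any family avoiding the reserved matching leaves the graph k-connected.
  suffices hfam : ∃ W : Fin l → Σ v, G.Walk v v, (∀ i, (W i).2.IsHamiltonianCycle) ∧
      (∀ i i', i ≠ i' → Disjoint (W i).2.edgeSet (W i').2.edgeSet) ∧
      (∀ i, Disjoint (W i).2.edgeSet R) ∧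
      ∀ v X, ((fromEdgeSet (⋃ i, (W i).2.edgeSet)).nbrsIn v X).card ≤ 2 * l by
    obtain ⟨W, h1, h2, h3, h4⟩ := hfam
    refine ⟨W, h1, h2, ?_⟩
    refine h.isKConnected_of_matching (P := P) (M := M) (f := f) ?_ ?_ ?_ hMk.ge hMP hinj ?_
    · intro v X
      have e1 := card_nbrsIn_le_deleteEdges G (⋃ i, (W i).2.edgeSet) v X
      have e2 := h4 v X
      omega
    · intro v hv
      simpa [hP] using hv
    · intro v hv
      rw [hP, Finset.mem_union, Finset.mem_filter, not_or, not_and, not_le] at hv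
      rcases h.cover v with h5 | h5 | h5
      · exact absurd h5 hv.1
      · exact Or.inl h5
      · exact Or.inr ⟨h5, (hv.2 h5).le⟩
    · intro u hu
      refine ⟨(hM u hu).1, ?_⟩
      rw [deleteEdges_adj]
      refine ⟨(hM u hu).2, fun h5 => ?_⟩
      obtain ⟨i, hi⟩ := Set.mem_iUnion.1 h5
      exact Set.disjoint_left.1 (h3 i) hi ⟨u, hu, rfl⟩
  set D := S.filter fun s => l + 2 ≤ (G.nbrsIn s A).card ∧ l + 2 ≤ (G.nbrsIn s B).card with hD
  have hDS : D ⊆ S := Finset.filter_subset _ _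
  by_cases hD2 : 1 < D.card
  · obtain ⟨s, hs, t, ht, hst⟩ := Finset.one_lt_card.1 hD2
    rw [hD, Finset.mem_filter] at hs ht
    exact h.exists_family_of_two_rich hR hRA hRB hs.1 ht.1 hst hs.2.1 hs.2.2 ht.2.1 ht.2.2
  set U := S.filter fun s => (G.nbrsIn s A).card ≤ l + 1 with hU
  set U' := (S \ U) \ D with hU'
  have hUS : U ⊆ S := Finset.filter_subset _ _
  have hUD : Disjoint U D := by
    rw [Finset.disjoint_left]
    intro s hs hs'
    rw [hU, Finset.mem_filter] at hs
    rw [hD, Finset.mem_filter] at hs'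
    omega
  have hDSU : D ⊆ S \ U := fun s hs =>
    Finset.mem_sdiff.2 ⟨hDS hs, Finset.disjoint_right.1 hUD hs⟩
  have hScard : U.card + U'.card + D.card = S.card := by
    have e1 := Finset.card_sdiff_add_card_eq_card hUS
    have e2 := Finset.card_sdiff_add_card_eq_card hDSU
    rw [← hU'] at e2
    omega
  have hUB : ∀ s ∈ U', (G.nbrsIn s B).card ≤ l + 1 := by
    intro s hs
    simp only [hU', hU, hD, Finset.mem_sdiff, Finset.mem_filter] at hs
    by_contra hcon
    apply hs.2
    have h1 : ¬ (G.nbrsIn s A).card ≤ l + 1 := fun h => hs.1.2 ⟨hs.1.1, h⟩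
    exact ⟨hs.1.1, by omega, by omega⟩
  have hScov : ∀ s ∈ S, s ∈ U ∨ s ∈ U' ∨ s ∈ D := by
    intro s hs
    simp only [hU', Finset.mem_sdiff]
    tauto
  -- The chosen edges start from the part whose side, `A ∪ U'` or `B ∪ U`, is not larger. The at
  -- most one vertex of `D` belongs to neither.
  rcases le_total (A.card + U'.card) (B.card + U.card) with hle | hle
  · obtain ⟨g, hg⟩ := h.exists_star_map (U := U) (U' := U') hScov (by omega) (by omega)
    refine h.exists_family_of_stars hR hRA hRB hUS
      (fun s hs => (Finset.mem_filter.1 hs).2) hg fun X hXA hX => ?_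
    rw [← hMk]
    refine Finset.card_le_card fun a ha => ?_
    rcases memR _ _ (hX a ha) with h1 | h1
    · exact h1.1
    · exact absurd (h1.2 ▸ hAP (hXA ha)) (hM _ h1.1).1
  · obtain ⟨g, hg⟩ := h.symm.exists_star_map (U := U') (U' := U)
      (fun s hs => by have := hScov s hs; tauto) (by omega : D.card ≤ 1) (by omega)
    refine h.symm.exists_family_of_stars hR hRB hRA (U := U')
      (Finset.sdiff_subset.trans Finset.sdiff_subset) hUB hg fun X hXB hX => ?_
    rw [← hMk]
    refine (Finset.card_le_card (t := M.image f) fun a ha => ?_).trans Finset.card_image_le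
    rcases memR _ _ (hX a ha) with h1 | h1
    · exact absurd (hMP h1.1) (hBP a (hXB ha))
    · exact Finset.mem_image.2 ⟨_, h1.1, h1.2.symm⟩

end IsSplit

end SimpleGraph

/-! ### The main theorem -/

theorem corollary4p4 {V : Type*} [Fintype V] [DecidableEq V]
    (G : SimpleGraph V) [DecidableRel G.Adj] (k l : ℕ) (hk : 2 ≤ k) (hl : 2 ≤ l)
    (hconn : G.IsKConnected k)
    (hn : max ((k : ℤ) * l + max ((k : ℤ) * l - 6) (2 * (l : ℤ)) + 3 * (k : ℤ))
        (6 * (k : ℤ) + 8 * (l : ℤ) + 4 - 2 * ⌈((k : ℚ) - 2) / (k : ℚ)⌉) ≤ (Fintype.card V : ℤ))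
    (hdeg : (Fintype.card V : ℚ) / 2 ≤ (G.minDegree : ℚ))
    (hH : ∃ (v : V) (H : G.Walk v v), H.IsHamiltonianCycle ∧
      ¬ (G.deleteEdges H.edgeSet).IsKConnected k) :
    ∃ (v : Fin l → V) (H : ∀ i : Fin l, G.Walk (v i) (v i)),
      (∀ i, (H i).IsHamiltonianCycle) ∧
      (∀ i j, i ≠ j → Disjoint (H i).edgeSet (H j).edgeSet) ∧
      (G.deleteEdges (⋃ i, (H i).edgeSet)).IsKConnected k := by
  -- The ceiling is at most 1. Together with n ≤ 2d this gives d ≥ 3k + 4l + 1.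
  have hn' : 6 * k + 8 * l + 2 ≤ Fintype.card V := by
    have h1 : ⌈((k : ℚ) - 2) / (k : ℚ)⌉ ≤ 1 := by
      rw [Int.ceil_le]
      have : (0 : ℚ) < k := by exact_mod_cast (by omega : 0 < k)
      rw [div_le_iff₀ this]
      push_cast
      linarith
    have h2 := (le_max_right _ _).trans hn
    omega
  have hd : Fintype.card V ≤ 2 * G.minDegree := by
    have : (Fintype.card V : ℚ) ≤ 2 * G.minDegree := by linarith
    exact_mod_cast this
  have hdegree : ∀ v, G.minDegree ≤ (G.nbrsIn v Finset.univ).card := by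
    intro v
    refine (G.minDegree_le_degree v).trans (Finset.card_le_card fun w hw => ?_)
    simpa using hw
  obtain ⟨v, H, hH, hnot⟩ := hH
  obtain ⟨S, hS, hS'⟩ : ∃ S : Finset V, S.card < k ∧
      ¬ ((G.deleteEdges H.edgeSet).induce {v : V | v ∉ S}).Connected := by
    rw [SimpleGraph.isKConnected_iff (by omega)] at hnot
    push Not at hnot
    exact hnot
  obtain ⟨A, B, hA, hB, hAB, hSA, hSB, hcov, hno⟩ :=
    SimpleGraph.exists_split_of_not_connected (by omega) hS'
  -- An edge of `G` lost on deleting E(H) lies on `H`, which has only two edges at each vertex.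
  have hcross : ∀ a X, (∀ b ∈ X, ¬ (G.deleteEdges H.edgeSet).Adj a b) →
      (G.nbrsIn a X).card ≤ 2 := by
    intro a X hX
    refine (Finset.card_le_card fun b hb => ?_).trans (hH.card_nbrsIn_le_two a X)
    rw [SimpleGraph.mem_nbrsIn] at hb
    have h1 := hX b hb.1
    rw [SimpleGraph.deleteEdges_adj] at h1
    rw [SimpleGraph.mem_nbrsIn, SimpleGraph.fromEdgeSet_adj]
    exact ⟨hb.1, by_contra fun h2 => h1 ⟨hb.2, h2⟩, hb.2.ne⟩
  have hsplit : G.IsSplit k l G.minDegree A B S :=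
    { disjAB := hAB
      disjSA := hSA
      disjSB := hSB
      cover := hcov
      crossA := fun a ha => hcross a B (hno a ha)
      crossB := fun b hb => hcross b A fun a ha h => hno a ha b hb h.symm
      neA := hA
      neB := hB
      cardS := hS
      two_le_l := hl
      degree := hdegree
      card_le := hd
      le_d := by omega }
  obtain ⟨W, h1, h2, h3⟩ := hsplit.exists_family hconn
  exact ⟨fun i => (W i).1, fun i => (W i).2, h1, h2, h3⟩
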